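/- **Notation.** Write $\hat f(\xi)=\int_{\mathbb R^2} f(x)e^{-2\pi i x\xi}\,dx$ (extended to $L^2(\mathbb R^2)$), $\langle f,g\rangle=\int f\bar g$, $T_yf(x)=f(x-y)$ and $\mathrm{Dil}_Mf(x)=|\det M|^{1/2}f(Mx)$. For $j\ge 1$, $0\le k\le 2^j-1$ let $$A_{j,k}=\begin{bmatrix}4^j&0\\0&2^j\end{bmatrix}\begin{bmatrix}\cos\frac{2k\pi}{2^j}&-\sin\frac{2k\pi}{2^j}\\ \sin\frac{2k\pi}{2^j}&\cos\frac{2k\pi}{2^j}\end{bmatrix},\qquad B_{j,k}=(A_{j,k}^*)^{-1},\qquad \|g\|_*=\operatorname*{ess\,sup}_{\xi}\sum_{j\ge1}\sum_{k=0}^{2^j-1}|g(B_{j,k}\xi)|.$$ Let $\Lambda=P\mathbb Z^2$ with $P\in\mathbb R^{2\times2}$ invertible, $|\Lambda|=|\det P|$, $\Gamma=(P^{-1})^*\mathbb Z^2$, and let $a,b>0$ be the singular values of $P$. **Windows.** Let $\delta>0$, $\varsigma>2$, $C_0\in\mathbb R$, and let $\varphi_0,\varphi\in L^2(\mathbb R^2)$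 and $A,B$ satisfy, for a.e. $\xi$, $$0<A\le|\widehat{\varphi_0}(\xi)|^2+\sum_{j\ge1}\sum_{k=0}^{2^j-1}|\hat\varphi(B_{j,k}\xi)|^2\le B<\infty,\quad |\widehat{\varphi_0}(\xi)|\le C_0e^{-\delta|\xi|^2},\quad |\hat\varphi(\xi)|\le C_0\min(1,|\xi_1|^{\varsigma})e^{-\delta|\xi|^2}.$$ Put $\varphi_{0,\lambda}=T_\lambda\varphi_0$, $\varphi_{j,k,\lambda}=\mathrm{Dil}_{A_{j,k}}T_\lambda\varphi$, $$\Theta(\zeta)=\operatorname*{ess\,sup}_{\xi}\Big(|\widehat{\varphi_0}(\xi)||\widehat{\varphi_0}(\xi-\zeta)|+\sum_{j\ge1}\sum_{k=0}^{2^j-1}|\hat\varphi(B_{j,k}\xi)||\hat\varphi(B_{j,k}\xi-\zeta)|\Big),\qquad \Delta(\Lambda)=\sum_{\gamma\in\Gamma\setminus\{0\}}\max\{\Theta(\gamma),\Theta(-\gamma)\}.$$ **Modified window.** Let $\varepsilon>0$, let $\eta:\mathbb R^2\to[0,1]$ be smooth with compact support not containing the origin and $\eta=1$ a.e. on $\{|\hat\varphi|>\varepsilon\}$,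 and let $\hat\psi=\eta\hat\varphi$, $\psi_{j,k,\lambda}=\mathrm{Dil}_{A_{j,k}}T_\lambda\psi$ and $$\widetilde m(\xi)=|\widehat{\varphi_0}(\xi)|^2+\sum_{j\ge1}\sum_{k=0}^{2^j-1}\hat\varphi(B_{j,k}\xi)\overline{\hat\psi(B_{j,k}\xi)}.$$ **Theorem.** There are $K>0$ and $0<\tau<\delta$, depending only on $\delta,\varsigma,C_0$, such that the following holds for all data as above. If $\varepsilon\|\hat\varphi\|_*<A$ and $\Delta(\Lambda)<A-\varepsilon\|\hat\varphi\|_*$, then the series defining $\widetilde m$ converges absolutely a.e. and $A-\varepsilon\|\hat\varphi\|_*\le\widetilde m\le B+\varepsilon\|\hat\varphi\|_*$ a.e.; there are $\widetilde{\varphi_{0,\lambda}},\widetilde\varphi_{j,k,\lambda}\in L^2(\mathbb R^2)$ with Fourier transforms $\widehat{\varphi_{0,\lambda}}/\widetilde m$ and $\widehat{\psi_{j,k,\lambda}}/\widetilde m$; and for every $f\in L^2(\mathbb R^2)$ the series in $$\widetilde f=|\Lambda|\Big(\sum_{\lambda\in\Lambda}\langle f,\widetilde{\varphi_{0,\lambda}}\rangle\varphi_{0,\lambda}+\sum_{j\ge1}\sum_{k=0}^{2^j-1}\sum_{\lambda\in\Lambda}\langle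 f,\widetilde\varphi_{j,k,\lambda}\rangle\varphi_{j,k,\lambda}\Big)$$ converge unconditionally in $L^2(\mathbb R^2)$ and $$\|f-\widetilde f\|_2\le\frac{\Delta(\Lambda)}{A-\varepsilon\|\hat\varphi\|_*}\|f\|_2\le\frac{K}{A-\varepsilon\|\hat\varphi\|_*}\big(e^{-\tau/a^2}+e^{-\tau/b^2}\big)\|f\|_2 .$$ -/

import Mathlib

open MeasureTheory
open scoped ENNReal FourierTransform ContDiff ComplexConjugate

noncomputable section

namespace Wavepacket

/-- The Euclidean plane. -/
abbrev Plane : Type := EuclideanSpace ℝ (Fin 2)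

/-- The complex Hilbert space of square-integrable functions on the plane; `𝓕` on it is the
Plancherel extension of `f ↦ ∫ f(x) exp(-2πi x·ξ) dx`. -/
abbrev L2 : Type := Lp (α := Plane) ℂ 2 (volume : Measure Plane)

/-- The matrix `M` acting on the plane by `x ↦ M x`. -/
abbrev act (M : Matrix (Fin 2) (Fin 2) ℝ) : Plane →ₗ[ℝ] Plane := Matrix.toEuclideanLin M

/-! ### Parabolic dilations and rotations -/

/-- The rotation matrix of angle `θ`. -/
def rot (θ : ℝ) : Matrix (Fin 2) (Fin 2) ℝ :=
  !![Real.cos θ, -Real.sin θ; Real.sin θ, Real.cos θ]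

/-- The parabolic dilation matrix at scale `j`. -/
def parab (j : ℕ) : Matrix (Fin 2) (Fin 2) ℝ := !![(4 : ℝ) ^ j, 0; 0, (2 : ℝ) ^ j]

/-- The pairs `(j, k)` with `j ≥ 1` and `0 ≤ k ≤ 2 ^ j - 1`. -/
abbrev ScaleRot : Type := Σ j : ℕ+, Fin (2 ^ (j : ℕ))

/-- `A_{j,k} = D_j R_{2πk/2^j}`. -/
def matA (i : ScaleRot) : Matrix (Fin 2) (Fin 2) ℝ :=
  parab i.1 * rot (2 * (i.2 : ℕ) * Real.pi / 2 ^ (i.1 : ℕ))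

/-- `B_{j,k} = (A_{j,k}^*)⁻¹`. -/
def matB (i : ScaleRot) : Matrix (Fin 2) (Fin 2) ℝ := (matA i).transpose⁻¹

theorem det_matA_ne_zero (i : ScaleRot) : (matA i).det ≠ 0 := by
  have h : (rot (2 * (i.2 : ℕ) * Real.pi / 2 ^ (i.1 : ℕ))).det = 1 := by
    rw [rot, Matrix.det_fin_two_of]
    nlinarith [Real.sin_sq_add_cos_sq (2 * ((i.2 : ℕ) : ℝ) * Real.pi / 2 ^ (i.1 : ℕ))]
  rw [matA, Matrix.det_mul, h, parab, Matrix.det_fin_two_of]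
  have h4 : (4 : ℝ) ^ (i.1 : ℕ) ≠ 0 := by positivity
  have h2 : (2 : ℝ) ^ (i.1 : ℕ) ≠ 0 := by positivity
  simp [h4, h2]

/-! ### Translations and dilations on `L²` -/

theorem quasi_act {M : Matrix (Fin 2) (Fin 2) ℝ} (hM : M.det ≠ 0) :
    Measure.map (act M) (volume : Measure Plane)
      = ENNReal.ofReal |M.det⁻¹| • (volume : Measure Plane) := by
  have hdet : LinearMap.det (act M) = M.det := by
    simp [act]
  have h := Measure.map_linearMap_addHaar_eq_smul_addHaar (volume : Measure Plane)
    (f := act M) (by rw [hdet]; exact hM)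
  rw [h, hdet]

/-- The translation `T_y f (x) = f (x - y)`. -/
def transl (y : Plane) (f : L2) : L2 :=
  Lp.compMeasurePreserving (fun x => x - y) (measurePreserving_sub_right volume y) f

theorem memLp_dilate {M : Matrix (Fin 2) (Fin 2) ℝ} (hM : M.det ≠ 0) (f : L2) :
    MemLp (fun x : Plane => ((Real.sqrt |M.det| : ℝ) : ℂ) * f (act M x)) 2 volume := by
  have hmeas : AEMeasurable (act M) (volume : Measure Plane) :=
    (LinearMap.continuous_of_finiteDimensional (act M)).measurable.aemeasurable
  refine MemLp.const_mul ?_ _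
  refine MemLp.comp_of_map (g := (f : Plane → ℂ)) ?_ hmeas
  rw [quasi_act hM]
  exact (Lp.memLp f).smul_measure ENNReal.ofReal_ne_top

/-- The dilation `Dil_M f (x) = |det M|^{1/2} f (M x)` for an invertible matrix `M`. -/
def dilate (M : Matrix (Fin 2) (Fin 2) ℝ) (hM : M.det ≠ 0) (f : L2) : L2 :=
  (memLp_dilate hM f).toLp _

/-- The wavepacket `Dil_{A_{j,k}} T_y f`, that is `x ↦ 8^{j/2} f (A_{j,k} x - y)`. -/
def packet (f : L2) (i : ScaleRot) (y : Plane) : L2 :=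
  dilate (matA i) (det_matA_ne_zero i) (transl y f)

/-! ### Lattices -/

/-- The lattice `P ℤ²`. -/
def lattice (P : Matrix (Fin 2) (Fin 2) ℝ) : Set Plane :=
  Set.range fun n : Fin 2 → ℤ => act P (WithLp.toLp 2 fun l => (n l : ℝ))

/-- The dual lattice `(P⁻¹)^* ℤ²` of `P ℤ²`. -/
def dualLattice (P : Matrix (Fin 2) (Fin 2) ℝ) : Set Plane := lattice P⁻¹.transpose

/-! ### The quantities of the Daubechies-like criterion -/

/-- The star-norm `esssup_ξ ∑_{j,k} |g (B_{j,k} ξ)|`. -/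
def starNorm (g : Plane → ℂ) : ℝ≥0∞ :=
  essSup (fun ξ : Plane => ∑' i : ScaleRot, ‖g (act (matB i) ξ)‖ₑ) volume

/-- `m(ξ) = |φ̂₀(ξ)|² + ∑_{j,k} |φ̂(B_{j,k} ξ)|²`. -/
def coverSum (φ₀ φ : L2) (ξ : Plane) : ℝ≥0∞ :=
  ‖(𝓕 φ₀ : L2) ξ‖ₑ ^ 2 + ∑' i : ScaleRot, ‖(𝓕 φ : L2) (act (matB i) ξ)‖ₑ ^ 2

/-- The time-scale correlation function `Θ`. -/
def corr (φ₀ φ : L2) (ζ : Plane) : ℝ≥0∞ :=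
  essSup (fun ξ : Plane =>
    ‖(𝓕 φ₀ : L2) ξ‖ₑ * ‖(𝓕 φ₀ : L2) (ξ - ζ)‖ₑ
      + ∑' i : ScaleRot,
          ‖(𝓕 φ : L2) (act (matB i) ξ)‖ₑ * ‖(𝓕 φ : L2) (act (matB i) ξ - ζ)‖ₑ) volume

/-- `Δ(Λ) = ∑_{γ ∈ Γ \ {0}} max {Θ(γ), Θ(-γ)}` for `Λ = P ℤ²` with dual lattice `Γ`. -/
def latticeDelta (φ₀ φ : L2) (P : Matrix (Fin 2) (Fin 2) ℝ) : ℝ≥0∞ :=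
  ∑' γ : ↥(dualLattice P \ {0}), max (corr φ₀ φ γ) (corr φ₀ φ (-γ))

/-- The constant `A - ε ‖φ̂‖_*` (only used when `ε ‖φ̂‖_* < A`, where the subtraction is not
truncated). -/
def lowerBound (A ε : ℝ) (φ : L2) : ℝ≥0∞ :=
  ENNReal.ofReal A - ENNReal.ofReal ε * starNorm (𝓕 φ : L2)

/-- `m̃(ξ) = |φ̂₀(ξ)|² + ∑_{j,k} φ̂(B_{j,k} ξ) conj ψ̂(B_{j,k} ξ)`. -/
def modSymbol (φ₀ φ ψ : L2) (ξ : Plane) : ℂ :=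
  ((‖(𝓕 φ₀ : L2) ξ‖ ^ 2 : ℝ) : ℂ)
    + ∑' i : ScaleRot, (𝓕 φ : L2) (act (matB i) ξ) * conj ((𝓕 ψ : L2) (act (matB i) ξ))

/-- The standing assumptions on the windows: the covering condition with bounds `A` and `B`,
Gaussian decay of both windows in frequency and vanishing of order `ς` of `φ̂` in the direction
`ξ₁`. All inequalities are between functions in `L²`, hence hold almost everywhere. -/
structure AdmissibleWindows (δ ς C₀ A B : ℝ) (φ₀ φ : L2) : Prop where
  pos : 0 < A
  cover : ∀ᵐ ξ : Plane,
    ENNReal.ofReal A ≤ coverSum φ₀ φ ξ ∧ coverSum φ₀ φ ξ ≤ ENNReal.ofReal B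
  decay_coarse : ∀ᵐ ξ : Plane, ‖(𝓕 φ₀ : L2) ξ‖ ≤ C₀ * Real.exp (-δ * ‖ξ‖ ^ 2)
  decay_fine : ∀ᵐ ξ : Plane,
    ‖(𝓕 φ : L2) ξ‖ ≤ C₀ * (min 1 (|ξ 0| ^ ς) * Real.exp (-δ * ‖ξ‖ ^ 2))

/-- `η` is an admissible frequency cut-off for the window `φ` at level `ε`: a smooth function
with values in `[0,1]`, whose support is compact and does not contain the origin, and which
equals `1` on `{|φ̂| > ε}` (up to a null set, since `φ̂` is an element of `L²`). -/
structure IsCutoff (ε : ℝ) (φ : L2) (η : Plane → ℝ) : Prop where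
  smooth : ContDiff ℝ ∞ η
  range : ∀ ξ, η ξ ∈ Set.Icc (0 : ℝ) 1
  compact : HasCompactSupport η
  zero_notMem : (0 : Plane) ∉ tsupport η
  eq_one : ∀ᵐ ξ : Plane, ε < ‖(𝓕 φ : L2) ξ‖ → η ξ = 1

/-- `g ∈ L²` is the result of filtering `f ∈ L²` with the Fourier multiplier of symbol `σ`,
that is `ĝ = σ f̂`. -/
def IsFiltered (σ : Plane → ℂ) (f g : L2) : Prop :=
  ∀ᵐ ξ : Plane, (𝓕 g : L2) ξ = σ ξ * (𝓕 f : L2) ξ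

end Wavepacket

end

/-! All work takes place on the Fourier side, where a translation is a phase and a packet is a phase
times a dilated window. The symbol is `m̃ = |φ̂₀|² + ∑ η(B ξ)|φ̂(B ξ)|²`, a sum of nonnegative
terms. Where `η ≠ 1` one has `|φ̂| ≤ ε`, so removing the cut-off costs at most `ε ∑ |φ̂(B ξ)| ≤ ε
‖φ̂‖_*`; this is `lowerBound_le_symbolSum`. Hence `1/m̃` is a bounded real multiplier. Being
self-adjoint, it can be moved from the dual packets onto `f`, so that the coefficients of `f` become
those of `f'`, where `f̂' = f̂/m̃`, against the packets of `φ₀` and `ψ`.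

Pair the synthesis with a test function `g`. At a fixed scale the sum over the lattice is a Parseval
sum on a torus, for windowed functions periodized along the dual lattice
(`exists_hasSum_planeCoeff`). Its zero-shift terms, summed over the scales, give `∫ m̃ f̂' conj ĝ =
⟨f, g⟩` (`hasSum_diagonal`). The remaining terms couple frequencies that differ by a nonzero shift.
The inequality `2|xy| ≤ |x|² + |y|²` followed by a translation bounds them through `Θ(γ)` and
`Θ(-γ)` (`two_mul_tsum_offDiag_le`). Thus `2|⟨f - f̃, g⟩| ≤ Δ (‖f'‖² + ‖g‖²)`, and rescaling `g`
yields `‖f - f̃‖ ≤ Δ ‖f'‖` (`norm_sub_synthesis_le`). The same estimates show that the packets form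
a Bessel system, whence unconditional convergence.

For the exponential bound, the product of two shifted Gaussians contributes `exp(-δ|ζ|²/4)` to
`Θ(ζ)`, and what is left sums over all scales and rotations to a constant uniform in `ξ`
(`tsum_windowProfile_le`, `corr_le`). A dual lattice point indexed by `n` has length at least
`|n|/a`, with `a` the largest singular value of `P`. If `a ≤ 1`, half of the exponent pays for the
sum over `n` and half gives `exp(-δ/(8a²))`. If `a ≥ 1`, this exponential is bounded below, and `Δ ≤
A` together with a bound on `A` in terms of `δ, ς, C₀` suffices (`latticeDelta_le`). -/

noncomputable section

namespace Wavepacket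

/-! ### Periodization over the integer lattice -/

section Periodization

variable {d : Type*}

/-- The integer vector `n` as a real vector. -/
def intVec (n : d → ℤ) : d → ℝ := fun l => (n l : ℝ)

theorem intVec_zero : intVec (0 : d → ℤ) = 0 := by
  ext l; simp [intVec]

theorem intVec_add (n m : d → ℤ) : intVec (n + m) = intVec n + intVec m := by
  ext l; simp [intVec]

/-- The periodization of `H` over the integer lattice. -/
def periodize (H : (d → ℝ) → ℂ) (x : d → ℝ) : ℂ := ∑' n : d → ℤ, H (x + intVec n)

/-- The periodization of `‖H‖` over the integer lattice. -/
def periodizeNorm (H : (d → ℝ) → ℂ) (x : d → ℝ) : ℝ≥0∞ := ∑' n : d → ℤ, ‖H (x + intVec n)‖ₑ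

theorem periodize_add (H : (d → ℝ) → ℂ) (x : d → ℝ) (m : d → ℤ) :
    periodize H (x + intVec m) = periodize H x := by
  rw [periodize, periodize, ← (Equiv.addRight m).tsum_eq (fun n => H (x + intVec n))]
  refine tsum_congr fun n => ?_
  rw [Equiv.coe_addRight, intVec_add, add_assoc, add_comm (intVec m)]

theorem periodizeNorm_add (H : (d → ℝ) → ℂ) (x : d → ℝ) (m : d → ℤ) :
    periodizeNorm H (x + intVec m) = periodizeNorm H x := by
  rw [periodizeNorm, periodizeNorm, ← (Equiv.addRight m).tsum_eq (fun n => ‖H (x + intVec n)‖ₑ)]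
  refine tsum_congr fun n => ?_
  rw [Equiv.coe_addRight, intVec_add, add_assoc, add_comm (intVec m)]

theorem enorm_periodize_le (H : (d → ℝ) → ℂ) (x : d → ℝ) :
    ‖periodize H x‖ₑ ≤ periodizeNorm H x := by
  exact enorm_tsum_le_tsum_enorm

/-- The half-open unit cube. -/
def unitCube (d : Type*) : Set (d → ℝ) :=
  {x | ∀ i, x i ∈ Set.Ioc ((0 : d → ℝ) i) ((0 : d → ℝ) i + 1)}

variable [Fintype d]

theorem measurableSet_unitCube : MeasurableSet (unitCube d) :=
  MeasurableSet.univ_pi' fun _ => measurableSet_Ioc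

/-- The integer translates of the cube tile the space. The unfolding identities below all reduce to
this decomposition of Lebesgue measure. -/
theorem sum_map_restrict_unitCube :
    Measure.sum (fun n : d → ℤ =>
      ((volume : Measure (d → ℝ)).restrict (unitCube d)).map (· + intVec n)) = volume := by
  have h (n : d → ℤ) : ((volume : Measure (d → ℝ)).restrict (unitCube d)).map (· + intVec n)
      = volume.restrict ((fun x => x - intVec n) ⁻¹' unitCube d) := by
    have hs : MeasurableSet ((fun x : d → ℝ => x - intVec n) ⁻¹' unitCube d) :=
      measurableSet_unitCube.preimage (by fun_prop)
    have := (measurePreserving_add_right (volume : Measure (d → ℝ)) (intVec n)).restrict_preimage hs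
    rw [← this.map_eq]
    congr 2
    ext x; simp
  simp_rw [h]
  rw [← Measure.restrict_iUnion]
  · convert Measure.restrict_univ
    rw [Set.eq_univ_iff_forall]
    intro x
    rw [Set.mem_iUnion]
    -- The cube is open on the left and closed on the right, so the cell of `x` is given by the
    -- ceiling minus one and not by the floor.
    refine ⟨fun i => ⌈x i⌉ - 1, fun i => ?_⟩
    simp only [intVec, Pi.sub_apply, Pi.zero_apply, Set.mem_Ioc, Int.cast_sub, Int.cast_one]
    constructor <;> linarith [Int.le_ceil (x i), Int.ceil_lt_add_one (x i)]
  · intro n m hnm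
    rw [Function.onFun, Set.disjoint_left]
    intro x hn hm
    apply hnm
    ext i
    have h1 := hn i
    have h2 := hm i
    simp only [intVec, Pi.sub_apply, Pi.zero_apply, Set.mem_Ioc] at h1 h2
    have h3 : (n i : ℝ) < m i + 1 := by linarith
    have h4 : (m i : ℝ) < n i + 1 := by linarith
    norm_cast at h3 h4
    omega
  · intro n
    exact measurableSet_unitCube.preimage (by fun_prop)

theorem lintegral_eq_tsum_unitCube {f : (d → ℝ) → ℝ≥0∞} (hf : Measurable f) :
    ∫⁻ x, f x = ∑' n : d → ℤ, ∫⁻ x in unitCube d, f (x + intVec n) := by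
  conv_lhs => rw [← sum_map_restrict_unitCube (d := d), lintegral_sum_measure]
  refine tsum_congr fun n => ?_
  rw [lintegral_map hf (by fun_prop)]

theorem hasSum_integral_unitCube {f : (d → ℝ) → ℂ} (hf : Integrable f) :
    HasSum (fun n : d → ℤ => ∫ x in unitCube d, f (x + intVec n)) (∫ x, f x) := by
  have h := hf
  rw [← sum_map_restrict_unitCube (d := d)] at h
  have h2 := hasSum_integral_measure h
  rw [sum_map_restrict_unitCube] at h2
  refine h2.congr_fun fun n => ?_
  exact (integral_map (by fun_prop) (h.mono_measure (Measure.le_sum _ n)).1).symm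

theorem measurable_periodizeNorm {H : (d → ℝ) → ℂ} (hH : Measurable H) :
    Measurable (periodizeNorm H) :=
  Measurable.tsum fun n => (hH.comp (measurable_add_const (intVec n))).enorm

theorem aestronglyMeasurable_tsum {α ι : Type*} [Countable ι] [MeasurableSpace α] {μ : Measure α}
    {f : ι → α → ℂ} (hf : ∀ i, AEStronglyMeasurable (f i) μ)
    (h : ∀ᵐ x ∂μ, Summable fun i => f i x) :
    AEStronglyMeasurable (fun x => ∑' i, f i x) μ := by
  refine aestronglyMeasurable_of_tendsto_ae (Filter.atTop : Filter (Finset ι))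
    (f := fun s x => ∑ i ∈ s, f i x) (fun s => ?_) ?_
  · exact Finset.aestronglyMeasurable_fun_sum s fun i _ => hf i
  · filter_upwards [h] with x hx using hx.hasSum

/-- The correlation of `H₁` and `H₂` along the integer lattice. -/
def latticeEnergy (H₁ H₂ : (d → ℝ) → ℂ) : ℝ≥0∞ :=
  ∑' n : d → ℤ, ∫⁻ x, ‖H₁ (x + intVec n)‖ₑ * ‖H₂ x‖ₑ

theorem lintegral_periodizeNorm_mul {H₁ H₂ : (d → ℝ) → ℂ} (h₁ : Measurable H₁)
    (h₂ : Measurable H₂) :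
    ∫⁻ x, periodizeNorm H₁ x * ‖H₂ x‖ₑ = latticeEnergy H₁ H₂ := by
  unfold periodizeNorm latticeEnergy
  rw [← lintegral_tsum]
  · simp_rw [ENNReal.tsum_mul_right]
  · intro n
    exact ((h₁.comp (measurable_add_const (intVec n))).enorm.mul h₂.enorm).aemeasurable

/-- Unfolding: one periodization is constant along the lattice, and the other one turns the integral
over the cube into an integral over the space. For `H₁ = H₂` the energy is therefore the squared
`L²` norm of the periodized modulus, so its finiteness puts the periodization in `L²` of the torus.
-/
theorem lintegral_unitCube_periodizeNorm_mul {H₁ H₂ : (d → ℝ) → ℂ} (h₁ : Measurable H₁)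
    (h₂ : Measurable H₂) :
    ∫⁻ x in unitCube d, periodizeNorm H₁ x * periodizeNorm H₂ x = latticeEnergy H₁ H₂ := by
  rw [← lintegral_periodizeNorm_mul h₁ h₂,
    lintegral_eq_tsum_unitCube (f := fun x => periodizeNorm H₁ x * ‖H₂ x‖ₑ)
      ((measurable_periodizeNorm h₁).mul h₂.enorm)]
  simp_rw [periodizeNorm_add]
  rw [← lintegral_tsum]
  · simp_rw [ENNReal.tsum_mul_left]
    rfl
  · intro n
    exact ((measurable_periodizeNorm h₁).mul
      (h₂.comp (measurable_add_const (intVec n))).enorm).aemeasurable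

theorem latticeEnergy_lt_top {H₁ H₂ : (d → ℝ) → ℂ} (h₁ : Measurable H₁) (h₂ : Measurable H₂)
    (e₁ : latticeEnergy H₁ H₁ < ⊤) (e₂ : latticeEnergy H₂ H₂ < ⊤) :
    latticeEnergy H₁ H₂ < ⊤ := by
  rw [← lintegral_unitCube_periodizeNorm_mul h₁ h₂]
  rw [← lintegral_unitCube_periodizeNorm_mul h₁ h₁] at e₁
  rw [← lintegral_unitCube_periodizeNorm_mul h₂ h₂] at e₂
  refine lt_of_le_of_lt (lintegral_mono (g := fun x => periodizeNorm H₁ x * periodizeNorm H₁ x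
    + periodizeNorm H₂ x * periodizeNorm H₂ x) fun x => ?_) ?_
  · rcases le_total (periodizeNorm H₁ x) (periodizeNorm H₂ x) with h | h
    · exact le_add_left (by gcongr)
    · exact le_add_right (by gcongr)
  · rw [lintegral_add_left (f := fun x => periodizeNorm H₁ x * periodizeNorm H₁ x)
      ((measurable_periodizeNorm h₁).mul (measurable_periodizeNorm h₁))]
    exact ENNReal.add_lt_top.2 ⟨e₁, e₂⟩

instance : IsFiniteMeasure ((volume : Measure (d → ℝ)).restrict (unitCube d)) := by
  refine ⟨?_⟩
  rw [Measure.restrict_apply_univ]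
  have : unitCube d = Set.pi Set.univ fun i : d => Set.Ioc (0 : ℝ) 1 := by
    ext x; simp [unitCube, Set.mem_pi]
  rw [this, volume_pi_pi]
  simp

/-- The cube has finite measure, so square-integrability of the periodized modulus there implies
integrability, via `t ≤ 1 + t²`. -/
theorem integrable_of_latticeEnergy {H : (d → ℝ) → ℂ} (h : Measurable H)
    (e : latticeEnergy H H < ⊤) : Integrable H := by
  refine ⟨h.aestronglyMeasurable, ?_⟩
  rw [hasFiniteIntegral_iff_enorm, lintegral_eq_tsum_unitCube h.enorm, ← lintegral_tsum
    (f := fun (n : d → ℤ) x => ‖H (x + intVec n)‖ₑ)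
    fun n => (h.comp (measurable_add_const (intVec n))).enorm.aemeasurable]
  rw [← lintegral_unitCube_periodizeNorm_mul h h] at e
  refine lt_of_le_of_lt (lintegral_mono (g := fun x => 1 + periodizeNorm H x * periodizeNorm H x)
    fun x => ?_) ?_
  · change periodizeNorm H x ≤ _
    rcases le_total (periodizeNorm H x) 1 with h | h
    · exact le_add_right h
    · exact le_add_left (le_mul_of_one_le_left zero_le h)
  · rw [lintegral_add_left measurable_const, lintegral_const, one_mul]
    exact ENNReal.add_lt_top.2 ⟨measure_lt_top _ _, e⟩

theorem ae_unitCube_periodizeNorm_lt_top {H : (d → ℝ) → ℂ} (h : Measurable H)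
    (e : latticeEnergy H H < ⊤) :
    ∀ᵐ x ∂(volume : Measure (d → ℝ)).restrict (unitCube d), periodizeNorm H x < ⊤ := by
  rw [← lintegral_unitCube_periodizeNorm_mul h h] at e
  filter_upwards [ae_lt_top ((measurable_periodizeNorm h).mul (measurable_periodizeNorm h)) e.ne]
    with x hx
  rw [Pi.mul_apply] at hx
  by_contra hc
  rw [not_lt, top_le_iff] at hc
  simp [hc] at hx

theorem summable_of_tsum_enorm {ι : Type*} {f : ι → ℂ} (h : ∑' i, ‖f i‖ₑ ≠ ⊤) : Summable f := by
  apply Summable.of_norm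
  have := ENNReal.summable_toReal h
  simpa using this

theorem aestronglyMeasurable_periodize {H : (d → ℝ) → ℂ} (h : Measurable H)
    (e : latticeEnergy H H < ⊤) :
    AEStronglyMeasurable (periodize H) ((volume : Measure (d → ℝ)).restrict (unitCube d)) := by
  refine aestronglyMeasurable_tsum (fun n => ?_) ?_
  · exact (h.comp (measurable_add_const (intVec n))).aestronglyMeasurable
  · filter_upwards [ae_unitCube_periodizeNorm_lt_top h e] with x hx
    exact summable_of_tsum_enorm hx.ne

theorem ae_of_ae_unitCube {p : (d → ℝ) → Prop} (hp : ∀ x (n : d → ℤ), p (x + intVec n) ↔ p x)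
    (h : ∀ᵐ x ∂(volume : Measure (d → ℝ)).restrict (unitCube d), p x) : ∀ᵐ x, p x := by
  rw [← sum_map_restrict_unitCube (d := d), Measure.ae_sum_iff]
  intro n
  rw [(measurableEmbedding_addRight (intVec n)).ae_map_iff]
  filter_upwards [h] with x hx using (hp x n).2 hx

theorem ae_summable_periodize {H : (d → ℝ) → ℂ} (h : Measurable H)
    (e : latticeEnergy H H < ⊤) : ∀ᵐ x : d → ℝ, Summable fun n => H (x + intVec n) := by
  have : ∀ᵐ x : d → ℝ, periodizeNorm H x < ⊤ :=
    ae_of_ae_unitCube (fun x n => by rw [periodizeNorm_add]) (ae_unitCube_periodizeNorm_lt_top h e)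
  filter_upwards [this] with x hx using summable_of_tsum_enorm hx.ne

theorem aestronglyMeasurable_periodize' {H : (d → ℝ) → ℂ} (h : Measurable H)
    (e : latticeEnergy H H < ⊤) :
    AEStronglyMeasurable (periodize H) (volume : Measure (d → ℝ)) := by
  refine aestronglyMeasurable_tsum (fun n => ?_) (ae_summable_periodize h e)
  exact (h.comp (measurable_add_const (intVec n))).aestronglyMeasurable

/-- Unfolding against a periodic factor. It is applied with `g` a character, giving Fourier
coefficients, and with `g` another periodization, giving the Parseval pairing. -/
theorem integral_unitCube_mul_periodize {g H : (d → ℝ) → ℂ}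
    (hg : ∀ x (n : d → ℤ), g (x + intVec n) = g x) (hgm : AEStronglyMeasurable g) (h : Measurable H)
    (hi : ∫⁻ x, ‖g x‖ₑ * ‖H x‖ₑ < ⊤) :
    ∫ x in unitCube d, g x * periodize H x = ∫ x, g x * H x := by
  have hint : Integrable (fun x => g x * H x) := by
    refine ⟨hgm.mul h.aestronglyMeasurable, ?_⟩
    rw [hasFiniteIntegral_iff_enorm]
    simpa [enorm_mul] using hi
  rw [← (hasSum_integral_unitCube hint).tsum_eq]
  simp_rw [hg, periodize, ← tsum_mul_left]
  rw [integral_tsum]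
  · intro n
    exact (hgm.restrict).mul (h.comp (measurable_add_const (intVec n))).aestronglyMeasurable
  -- Tiling was proved for measurable integrands, while `g` is only a.e. measurable. The
  -- representative `g'` need not be periodic, but it agrees with `g` a.e. on every translate of the
  -- cube.
  · let g' := hgm.mk g
    have hg' : Measurable g' := hgm.stronglyMeasurable_mk.measurable
    have e1 : ∫⁻ x, ‖g x‖ₑ * ‖H x‖ₑ = ∫⁻ x, ‖g' x‖ₑ * ‖H x‖ₑ := by
      refine lintegral_congr_ae ?_
      filter_upwards [hgm.ae_eq_mk] with x hx
      rw [hx]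
    have e2 : ∑' n : d → ℤ, ∫⁻ x in unitCube d, ‖g x * H (x + intVec n)‖ₑ
        = ∫⁻ x, ‖g' x‖ₑ * ‖H x‖ₑ := by
      rw [lintegral_eq_tsum_unitCube (f := fun x => ‖g' x‖ₑ * ‖H x‖ₑ) (hg'.enorm.mul h.enorm)]
      refine tsum_congr fun n => lintegral_congr_ae (ae_restrict_of_ae ?_)
      have := (measurePreserving_add_right (volume : Measure (d → ℝ))
        (intVec n)).quasiMeasurePreserving.ae hgm.ae_eq_mk
      filter_upwards [this] with x hx
      rw [enorm_mul, show g' (x + intVec n) = g (x + intVec n) from hx.symm, hg]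
    rw [e2, ← e1]
    exact hi.ne

end Periodization

end Wavepacket

end

/-! ### Parseval's identity on the torus for periodized functions -/

noncomputable section

namespace Wavepacket

theorem ENNReal_tsum_eq_add_tsum_ne {ι : Type*} (f : ι → ℝ≥0∞) (b : ι) :
    ∑' n, f n = f b + ∑' n : {n // n ≠ b}, f n := by
  classical
  rw [ENNReal.tsum_eq_add_tsum_ite b]
  congr 1
  rw [show (∑' n : {n // n ≠ b}, f n) = ∑' n, Set.indicator {n | n ≠ b} f n from
    tsum_subtype {n | n ≠ b} f]
  refine tsum_congr fun n => ?_
  by_cases h : n = b <;> simp [h]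

theorem tsum_eq_add_tsum_ne {ι : Type*} {f : ι → ℂ} (hf : Summable f) (b : ι) :
    ∑' n, f n = f b + ∑' n : {n // n ≠ b}, f n := by
  classical
  rw [hf.tsum_eq_add_tsum_ite b]
  congr 1
  rw [show (∑' n : {n // n ≠ b}, f n) = ∑' n, Set.indicator {n | n ≠ b} f n from
    tsum_subtype {n | n ≠ b} f]
  refine tsum_congr fun n => ?_
  by_cases h : n = b <;> simp [h]

section Torus

variable {d : Type*}

-- The Haar measure of total mass one, for which the characters are orthonormal.
local instance : MeasureSpace UnitAddCircle := ⟨AddCircle.haarAddCircle⟩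

/-- The representative in the unit cube of a point of the torus. -/
def torusLift (y : UnitAddTorus d) : d → ℝ := (UnitAddTorus.measurableEquivPiIoc 0 y).1

theorem coe_torusLift (y : UnitAddTorus d) : (fun i => (torusLift y i : UnitAddCircle)) = y :=
  (UnitAddTorus.measurableEquivPiIoc 0).symm_apply_apply y

variable [Fintype d]

theorem measurePreserving_torusLift :
    MeasurePreserving (torusLift (d := d)) volume (volume.restrict (unitCube d)) :=
  (measurePreserving_subtype_coe measurableSet_unitCube).comp
    (UnitAddTorus.measurePreserving_equivPiIoc 0)

theorem measurableEmbedding_torusLift : MeasurableEmbedding (torusLift (d := d)) :=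
  (MeasurableEmbedding.subtype_coe measurableSet_unitCube).comp
    (UnitAddTorus.measurableEquivPiIoc 0).measurableEmbedding

/-- The character `x ↦ exp (2πi n·x)`. -/
def character (n : d → ℤ) (x : d → ℝ) : ℂ :=
  Complex.exp (2 * Real.pi * Complex.I * ((∑ l, n l * x l : ℝ) : ℂ))

theorem norm_character (n : d → ℤ) (x : d → ℝ) : ‖character n x‖ = 1 := by
  rw [character, show 2 * (Real.pi : ℂ) * Complex.I * ((∑ l, n l * x l : ℝ) : ℂ)
    = ((2 * Real.pi * ∑ l, n l * x l : ℝ) : ℂ) * Complex.I by push_cast; ring]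
  exact Complex.norm_exp_ofReal_mul_I _

theorem continuous_character (n : d → ℤ) : Continuous (character n) := by
  unfold character
  fun_prop

theorem character_add_intVec (n m : d → ℤ) (x : d → ℝ) :
    character n (x + intVec m) = character n x := by
  have : (2 * Real.pi * Complex.I * ((∑ l, n l * (x + intVec m) l : ℝ) : ℂ))
      = 2 * Real.pi * Complex.I * ((∑ l, n l * x l : ℝ) : ℂ)
        + ((∑ l, n l * m l : ℤ) : ℂ) * (2 * Real.pi * Complex.I) := by
    simp only [intVec, Pi.add_apply, mul_add, Finset.sum_add_distrib]
    push_cast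
    ring
  rw [character, this, Complex.exp_add, Complex.exp_int_mul_two_pi_mul_I, mul_one, character]

theorem mFourier_coe (n : d → ℤ) (x : d → ℝ) :
    UnitAddTorus.mFourier n (fun i => (x i : UnitAddCircle)) = character n x := by
  simp only [UnitAddTorus.mFourier, ContinuousMap.coe_mk, character, fourier_coe_apply]
  rw [← Complex.exp_sum]
  congr 1
  push_cast
  rw [Finset.mul_sum]
  refine Finset.sum_congr rfl fun l _ => ?_
  ring

/-- The Fourier transform of `H` at the integer point `-n`. -/
def latticeCoeff (H : (d → ℝ) → ℂ) (n : d → ℤ) : ℂ := ∫ x, character n x * H x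

theorem memLp_periodize {H : (d → ℝ) → ℂ} (h : Measurable H) (e : latticeEnergy H H < ⊤) :
    MemLp (periodize H) 2 ((volume : Measure (d → ℝ)).restrict (unitCube d)) := by
  refine ⟨aestronglyMeasurable_periodize h e, ?_⟩
  rw [eLpNorm_lt_top_iff_lintegral_rpow_enorm_lt_top two_ne_zero ENNReal.ofNat_ne_top]
  rw [← lintegral_unitCube_periodizeNorm_mul h h] at e
  refine lt_of_le_of_lt (lintegral_mono fun x => ?_) e
  rw [ENNReal.toReal_ofNat, ENNReal.rpow_ofNat, sq]
  gcongr <;> exact enorm_periodize_le H x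

/-- The periodization of `H` as a function on the torus. -/
def torusPeriodize {H : (d → ℝ) → ℂ} (h : Measurable H) (e : latticeEnergy H H < ⊤) :
    Lp ℂ 2 (volume : Measure (UnitAddTorus d)) :=
  ((memLp_periodize h e).comp_measurePreserving measurePreserving_torusLift).toLp _

theorem mFourierCoeff_torusPeriodize {H : (d → ℝ) → ℂ} (h : Measurable H)
    (e : latticeEnergy H H < ⊤) (n : d → ℤ) :
    UnitAddTorus.mFourierCoeff (torusPeriodize h e) (-n) = latticeCoeff H n := by
  have h1 : UnitAddTorus.mFourierCoeff (torusPeriodize h e) (-n)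
      = ∫ y : UnitAddTorus d, character n (torusLift y) * periodize H (torusLift y) := by
    refine integral_congr_ae ?_
    filter_upwards [MemLp.coeFn_toLp ((memLp_periodize h e).comp_measurePreserving
      measurePreserving_torusLift)] with y hy
    rw [← mFourier_coe, coe_torusLift, neg_neg, smul_eq_mul, torusPeriodize, hy]
    rfl
  rw [h1, measurePreserving_torusLift.integral_comp measurableEmbedding_torusLift
    (fun x => character n x * periodize H x)]
  refine integral_unitCube_mul_periodize (fun x m => character_add_intVec n m x)
    (continuous_character n).aestronglyMeasurable h ?_
  have := (integrable_of_latticeEnergy h e).2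
  rw [hasFiniteIntegral_iff_enorm] at this
  simpa [← ofReal_norm, norm_character] using this

/-- Parseval for the two periodizations. Unfolding just one of them turns the pairing on the torus
into an integral over the whole space, from which the zero shift can be split off. -/
theorem hasSum_latticeCoeff {H₁ H₂ : (d → ℝ) → ℂ} (h₁ : Measurable H₁) (h₂ : Measurable H₂)
    (e₁ : latticeEnergy H₁ H₁ < ⊤) (e₂ : latticeEnergy H₂ H₂ < ⊤) :
    HasSum (fun n => latticeCoeff H₁ n * conj (latticeCoeff H₂ n))
      (∫ x, periodize H₁ x * conj (H₂ x)) := by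
  have h := UnitAddTorus.hasSum_prod_mFourierCoeff (torusPeriodize h₂ e₂) (torusPeriodize h₁ e₁)
  rw [← (Equiv.neg (d → ℤ)).hasSum_iff] at h
  simp only [Function.comp_def, Equiv.neg_apply, mFourierCoeff_torusPeriodize] at h
  have hV : ∫ t : UnitAddTorus d, conj (torusPeriodize h₂ e₂ t) * torusPeriodize h₁ e₁ t
      = ∫ x, periodize H₁ x * conj (H₂ x) := by
    have h1 : ∫ t : UnitAddTorus d, conj (torusPeriodize h₂ e₂ t) * torusPeriodize h₁ e₁ t
        = ∫ y : UnitAddTorus d, periodize H₁ (torusLift y)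
          * periodize (fun x => conj (H₂ x)) (torusLift y) := by
      refine integral_congr_ae ?_
      filter_upwards [MemLp.coeFn_toLp ((memLp_periodize h₁ e₁).comp_measurePreserving
        measurePreserving_torusLift), MemLp.coeFn_toLp ((memLp_periodize h₂ e₂).comp_measurePreserving
        measurePreserving_torusLift)] with y hy₁ hy₂
      rw [torusPeriodize, torusPeriodize, hy₁, hy₂, mul_comm, Function.comp_apply,
        Function.comp_apply, periodize, periodize, periodize, Complex.conj_tsum]
    rw [h1, measurePreserving_torusLift.integral_comp measurableEmbedding_torusLift
      (fun x => periodize H₁ x * periodize (fun x => conj (H₂ x)) x)]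
    refine integral_unitCube_mul_periodize (periodize_add H₁) (aestronglyMeasurable_periodize' h₁ e₁)
      (by fun_prop) ?_
    refine lt_of_le_of_lt (lintegral_mono fun x => ?_) ((lintegral_periodizeNorm_mul h₁ h₂).trans_lt
      (latticeEnergy_lt_top h₁ h₂ e₁ e₂))
    rw [RCLike.enorm_conj]
    gcongr
    exact enorm_periodize_le H₁ x
  rw [hV] at h
  exact h.congr_fun fun n => mul_comm _ _

/-- The off-diagonal part of the correlation along the integer lattice. -/
def offDiagEnergy (H₁ H₂ : (d → ℝ) → ℂ) : ℝ≥0∞ :=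
  ∑' n : {n : d → ℤ // n ≠ 0}, ∫⁻ x, ‖H₁ (x + intVec n)‖ₑ * ‖H₂ x‖ₑ

theorem latticeEnergy_eq (H₁ H₂ : (d → ℝ) → ℂ) :
    latticeEnergy H₁ H₂ = (∫⁻ x, ‖H₁ x‖ₑ * ‖H₂ x‖ₑ) + offDiagEnergy H₁ H₂ := by
  rw [latticeEnergy, ENNReal_tsum_eq_add_tsum_ne _ 0, offDiagEnergy]
  simp only [intVec_zero, add_zero]

/-- Poisson summation with an error term: the sum over nonzero shifts is estimated in absolute
value, and all cancellation is given up here. -/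
theorem enorm_sub_diag_le {H₁ H₂ : (d → ℝ) → ℂ} (h₁ : Measurable H₁) (h₂ : Measurable H₂)
    (e₁ : latticeEnergy H₁ H₁ < ⊤) (e₂ : latticeEnergy H₂ H₂ < ⊤) :
    ‖(∫ x, periodize H₁ x * conj (H₂ x)) - ∫ x, H₁ x * conj (H₂ x)‖ₑ ≤ offDiagEnergy H₁ H₂ := by
  have e₁₂ := latticeEnergy_lt_top h₁ h₂ e₁ e₂
  have i1 : Integrable fun x => periodize H₁ x * conj (H₂ x) := by
    refine ⟨(aestronglyMeasurable_periodize' h₁ e₁).mul (by fun_prop), ?_⟩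
    rw [hasFiniteIntegral_iff_enorm]
    refine lt_of_le_of_lt (lintegral_mono fun x => ?_)
      ((lintegral_periodizeNorm_mul h₁ h₂).trans_lt e₁₂)
    rw [enorm_mul, RCLike.enorm_conj]
    gcongr
    exact enorm_periodize_le H₁ x
  have i2 : Integrable fun x => H₁ x * conj (H₂ x) := by
    refine ⟨by fun_prop, ?_⟩
    rw [hasFiniteIntegral_iff_enorm]
    rw [latticeEnergy_eq] at e₁₂
    refine lt_of_le_of_lt (le_trans (le_of_eq ?_) le_self_add) e₁₂
    simp
  rw [← integral_sub i1 i2]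
  refine (enorm_integral_le_lintegral_enorm _).trans ?_
  rw [offDiagEnergy, ← lintegral_tsum]
  · refine lintegral_mono_ae ?_
    filter_upwards [ae_summable_periodize h₁ e₁] with x hx
    rw [← sub_mul, enorm_mul, RCLike.enorm_conj, ENNReal.tsum_mul_right]
    gcongr
    have : periodize H₁ x - H₁ x = ∑' n : {n : d → ℤ // n ≠ 0}, H₁ (x + intVec n) := by
      rw [periodize, tsum_eq_add_tsum_ne hx 0, intVec_zero, add_zero, add_sub_cancel_left]
    rw [this]
    exact enorm_tsum_le_tsum_enorm
  · intro n
    exact ((h₁.comp (measurable_add_const (intVec n.1))).enorm.mul h₂.enorm).aemeasurable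

end Torus

end Wavepacket

end

/-! ### Transfer to arbitrary lattices in the plane -/

noncomputable section

namespace Wavepacket

section PlaneLattice

theorem act_act (M N : Matrix (Fin 2) (Fin 2) ℝ) (x : Plane) :
    act M (act N x) = act (M * N) x := by
  simp [act, Matrix.toLpLin_apply]

theorem act_one (x : Plane) : act 1 x = x := by
  simp [act]

theorem act_inv_act {N : Matrix (Fin 2) (Fin 2) ℝ} (hN : N.det ≠ 0) (x : Plane) :
    act N⁻¹ (act N x) = x := by
  rw [act_act, Matrix.nonsing_inv_mul _ hN.isUnit, act_one]

theorem act_act_inv {N : Matrix (Fin 2) (Fin 2) ℝ} (hN : N.det ≠ 0) (x : Plane) :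
    act N (act N⁻¹ x) = x := by
  rw [act_act, Matrix.mul_nonsing_inv _ hN.isUnit, act_one]

theorem continuous_act (N : Matrix (Fin 2) (Fin 2) ℝ) : Continuous (act N) :=
  LinearMap.continuous_of_finiteDimensional (act N)

theorem measurable_act (N : Matrix (Fin 2) (Fin 2) ℝ) : Measurable (act N) :=
  (continuous_act N).measurable

/-- The integer vector `n` as a point of the plane. -/
def latVec (n : Fin 2 → ℤ) : Plane := WithLp.toLp 2 (intVec n)

/-- The coordinates of the plane in which the lattice `N⁻¹ ℤ²` is the integer lattice. -/
def latticeCoord (N : Matrix (Fin 2) (Fin 2) ℝ) (ξ : Plane) : Fin 2 → ℝ := WithLp.ofLp (act N ξ)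

/-- The inverse of `latticeCoord`. -/
def latticePoint (N : Matrix (Fin 2) (Fin 2) ℝ) (t : Fin 2 → ℝ) : Plane :=
  act N⁻¹ (WithLp.toLp 2 t)

variable {N : Matrix (Fin 2) (Fin 2) ℝ}

theorem latticePoint_latticeCoord (hN : N.det ≠ 0) (ξ : Plane) :
    latticePoint N (latticeCoord N ξ) = ξ := act_inv_act hN ξ

theorem latticePoint_add (t : Fin 2 → ℝ) (n : Fin 2 → ℤ) :
    latticePoint N (t + intVec n) = latticePoint N t + act N⁻¹ (latVec n) := by
  rw [latticePoint, latticePoint, latVec, WithLp.toLp_add, map_add]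

theorem measurable_latticeCoord : Measurable (latticeCoord N) :=
  ((PiLp.continuous_ofLp 2 _).comp (continuous_act N)).measurable

theorem measurable_latticePoint : Measurable (latticePoint N) :=
  ((continuous_act _).comp (PiLp.continuous_toLp 2 _)).measurable

theorem map_latticeCoord (hN : N.det ≠ 0) :
    Measure.map (latticeCoord N) (volume : Measure Plane)
      = ENNReal.ofReal |N.det⁻¹| • (volume : Measure (Fin 2 → ℝ)) := by
  rw [show latticeCoord N = WithLp.ofLp ∘ act N from rfl,
    ← Measure.map_map (PiLp.continuous_ofLp 2 _).measurable (measurable_act N), quasi_act hN,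
    Measure.map_smul, (PiLp.volume_preserving_ofLp (Fin 2)).map_eq]

theorem lintegral_comp_latticePoint (hN : N.det ≠ 0) {f : Plane → ℝ≥0∞} (hf : Measurable f) :
    ∫⁻ ξ, f ξ = ENNReal.ofReal |N.det⁻¹| * ∫⁻ t, f (latticePoint N t) := by
  rw [← smul_eq_mul, ← lintegral_smul_measure, ← map_latticeCoord hN,
    lintegral_map (f := fun t => f (latticePoint N t)) (hf.comp measurable_latticePoint)
      measurable_latticeCoord]
  simp_rw [latticePoint_latticeCoord hN]

theorem integral_comp_latticePoint (hN : N.det ≠ 0) {f : Plane → ℂ} (hf : Measurable f) :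
    ∫ ξ, f ξ = (|N.det⁻¹| : ℝ) * ∫ t, f (latticePoint N t) := by
  have h := integral_map (μ := (volume : Measure Plane)) (φ := latticeCoord N)
    (f := fun t => f (latticePoint N t)) measurable_latticeCoord.aemeasurable
    (hf.comp measurable_latticePoint).aestronglyMeasurable
  rw [map_latticeCoord hN, integral_smul_measure, ENNReal.toReal_ofReal (abs_nonneg _)] at h
  simp_rw [latticePoint_latticeCoord hN] at h
  rw [← h, Complex.real_smul]

/-- The coefficient of `H` at the `n`-th character of the lattice `N⁻¹ ℤ²`. -/
def planeCoeff (N : Matrix (Fin 2) (Fin 2) ℝ) (H : Plane → ℂ) (n : Fin 2 → ℤ) : ℂ :=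
  ∫ ξ, character n (latticeCoord N ξ) * H ξ

/-- The term at the lattice point `N⁻¹ n` of the correlation of `H₁` and `H₂`. -/
def shiftEnergy (N : Matrix (Fin 2) (Fin 2) ℝ) (H₁ H₂ : Plane → ℂ) (n : Fin 2 → ℤ) : ℝ≥0∞ :=
  ∫⁻ ξ, ‖H₁ (ξ + act N⁻¹ (latVec n))‖ₑ * ‖H₂ ξ‖ₑ

theorem shiftEnergy_eq (hN : N.det ≠ 0) {H₁ H₂ : Plane → ℂ} (h₁ : Measurable H₁)
    (h₂ : Measurable H₂) (n : Fin 2 → ℤ) :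
    shiftEnergy N H₁ H₂ n = ENNReal.ofReal |N.det⁻¹|
      * ∫⁻ t, ‖H₁ (latticePoint N (t + intVec n))‖ₑ * ‖H₂ (latticePoint N t)‖ₑ := by
  rw [shiftEnergy, lintegral_comp_latticePoint hN]
  · simp_rw [latticePoint_add]
  · exact (h₁.comp (measurable_add_const _)).enorm.mul h₂.enorm

theorem planeCoeff_eq (hN : N.det ≠ 0) {H : Plane → ℂ} (h : Measurable H) (n : Fin 2 → ℤ) :
    planeCoeff N H n = (|N.det⁻¹| : ℝ) * latticeCoeff (fun t => H (latticePoint N t)) n := by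
  have hc (t : Fin 2 → ℝ) : latticeCoord N (latticePoint N t) = t := by
    rw [latticeCoord, latticePoint, act_act_inv hN]
  rw [planeCoeff, integral_comp_latticePoint hN]
  · simp_rw [hc]
    rfl
  · exact ((continuous_character n).measurable.comp measurable_latticeCoord).mul h

theorem ofReal_abs_det_inv_ne_zero (hN : N.det ≠ 0) : ENNReal.ofReal |N.det⁻¹| ≠ 0 := by
  simpa using hN

theorem latticeEnergy_lt_top_of_shiftEnergy (hN : N.det ≠ 0) {H₁ H₂ : Plane → ℂ}
    (h₁ : Measurable H₁) (h₂ : Measurable H₂) (e : ∑' n, shiftEnergy N H₁ H₂ n < ⊤) :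
    latticeEnergy (fun t => H₁ (latticePoint N t)) (fun t => H₂ (latticePoint N t)) < ⊤ := by
  simp_rw [shiftEnergy_eq hN h₁ h₂, ENNReal.tsum_mul_left] at e
  by_contra hc
  rw [not_lt, top_le_iff, latticeEnergy] at hc
  rw [hc, ENNReal.mul_top (ofReal_abs_det_inv_ne_zero hN)] at e
  exact lt_irrefl _ e

/-- The Parseval estimate after the linear change of variables that makes the shift lattice
integral. -/
theorem exists_hasSum_planeCoeff (hN : N.det ≠ 0) {H₁ H₂ : Plane → ℂ} (h₁ : Measurable H₁)
    (h₂ : Measurable H₂) (e₁ : ∑' n, shiftEnergy N H₁ H₁ n < ⊤)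
    (e₂ : ∑' n, shiftEnergy N H₂ H₂ n < ⊤) :
    ∃ V : ℂ, HasSum (fun n => planeCoeff N H₁ n * conj (planeCoeff N H₂ n)) V ∧
      ‖V - (|N.det⁻¹| : ℝ) * ∫ ξ, H₁ ξ * conj (H₂ ξ)‖ₑ
        ≤ ENNReal.ofReal |N.det⁻¹| * ∑' n : {n : Fin 2 → ℤ // n ≠ 0}, shiftEnergy N H₁ H₂ n := by
  have m₁ : Measurable fun t => H₁ (latticePoint N t) := h₁.comp measurable_latticePoint
  have m₂ : Measurable fun t => H₂ (latticePoint N t) := h₂.comp measurable_latticePoint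
  have e₁' := latticeEnergy_lt_top_of_shiftEnergy hN h₁ h₁ e₁
  have e₂' := latticeEnergy_lt_top_of_shiftEnergy hN h₂ h₂ e₂
  -- Each of the two coefficients carries one Jacobian. Changing variables back in the diagonal
  -- integral uses up one of them, and the other stays as the factor in front.
  have hs := (hasSum_latticeCoeff m₁ m₂ e₁' e₂').mul_left ((|N.det⁻¹| : ℝ) ^ 2 : ℂ)
  refine ⟨_, hs.congr_fun fun n => ?_, ?_⟩
  · rw [planeCoeff_eq hN h₁, planeCoeff_eq hN h₂, map_mul, Complex.conj_ofReal]
    ring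
  · rw [integral_comp_latticePoint hN (by fun_prop)]
    simp_rw [shiftEnergy_eq hN h₁ h₂, ENNReal.tsum_mul_left]
    have hd := enorm_sub_diag_le m₁ m₂ e₁' e₂'
    rw [sq, mul_assoc, ← mul_sub, ← mul_sub, enorm_mul, enorm_mul]
    rw [show ‖((|N.det⁻¹| : ℝ) : ℂ)‖ₑ = ENNReal.ofReal |N.det⁻¹| by
      rw [← ofReal_norm]; simp]
    gcongr
    exact hd

/-- The diagonal case of the Parseval estimate, with diagonal and error recombined into the full
energy. It is the source of the Bessel bound for the packets. -/
theorem tsum_enorm_planeCoeff_sq_le (hN : N.det ≠ 0) {H : Plane → ℂ} (h : Measurable H) :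
    ∑' n, ‖planeCoeff N H n‖ₑ ^ 2
      ≤ ENNReal.ofReal |N.det⁻¹| * ∑' n : Fin 2 → ℤ, shiftEnergy N H H n := by
  by_cases e : ∑' n : Fin 2 → ℤ, shiftEnergy N H H n < ⊤
  · obtain ⟨V, hV, hb⟩ := exists_hasSum_planeCoeff hN h h e e
    have hV' : HasSum (fun n => ‖planeCoeff N H n‖ ^ 2) V.re := by
      have := Complex.hasSum_re hV
      refine this.congr_fun fun n => ?_
      rw [Complex.mul_conj, Complex.ofReal_re, Complex.normSq_eq_norm_sq]
    have h1 : ∑' n, ‖planeCoeff N H n‖ₑ ^ 2 = ENNReal.ofReal V.re := by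
      rw [← hV'.tsum_eq, ENNReal.ofReal_tsum_of_nonneg (fun n => by positivity) hV'.summable]
      refine tsum_congr fun n => ?_
      rw [ENNReal.ofReal_pow (norm_nonneg _), ofReal_norm]
    rw [h1, ENNReal_tsum_eq_add_tsum_ne _ 0, mul_add]
    calc ENNReal.ofReal V.re ≤ ENNReal.ofReal ‖V‖ :=
          ENNReal.ofReal_le_ofReal (Complex.re_le_norm V)
      _ = ‖(|N.det⁻¹| : ℝ) * (∫ ξ, H ξ * conj (H ξ))
          + (V - (|N.det⁻¹| : ℝ) * ∫ ξ, H ξ * conj (H ξ))‖ₑ := by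
        rw [ofReal_norm]; congr 1; ring
      _ ≤ _ := (enorm_add_le _ _).trans (add_le_add ?_ hb)
    rw [enorm_mul, show ‖((|N.det⁻¹| : ℝ) : ℂ)‖ₑ = ENNReal.ofReal |N.det⁻¹| by
      rw [← ofReal_norm]; simp]
    gcongr
    refine (enorm_integral_le_lintegral_enorm _).trans (le_of_eq ?_)
    rw [shiftEnergy, show latVec (0 : Fin 2 → ℤ) = 0 by rw [latVec, intVec_zero]; rfl]
    simp
  · rw [not_lt, top_le_iff] at e
    rw [e, ENNReal.mul_top (ofReal_abs_det_inv_ne_zero hN)]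
    exact le_top

end PlaneLattice

end Wavepacket

end

noncomputable section

namespace Wavepacket

section Multiplier

/-! ### Multiplication operators on `L²` -/

theorem enorm_sq_eq_lintegral (f : L2) : ‖f‖ₑ ^ 2 = ∫⁻ ξ, ‖f ξ‖ₑ ^ 2 := by
  rw [Lp.enorm_def, eLpNorm_eq_lintegral_rpow_enorm_toReal two_ne_zero ENNReal.ofNat_ne_top]
  rw [← ENNReal.rpow_natCast, ← ENNReal.rpow_mul]
  simp

theorem memLp_bounded_mul {σ : Plane → ℂ} (hσ : AEStronglyMeasurable σ) {C : ℝ}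
    (hC : ∀ᵐ ξ, ‖σ ξ‖ ≤ C) (f : L2) : MemLp (fun ξ => σ ξ * f ξ) 2 volume := by
  refine (Lp.memLp f).of_le_mul (c := C) (hσ.mul (Lp.aestronglyMeasurable f)) ?_
  filter_upwards [hC] with ξ hξ
  rw [norm_mul]
  gcongr

/-- Multiplication of `f ∈ L²` by a bounded function. -/
def multiply {σ : Plane → ℂ} (hσ : AEStronglyMeasurable σ) {C : ℝ} (hC : ∀ᵐ ξ, ‖σ ξ‖ ≤ C)
    (f : L2) : L2 := (memLp_bounded_mul hσ hC f).toLp _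

theorem multiply_ae {σ : Plane → ℂ} (hσ : AEStronglyMeasurable σ) {C : ℝ} (hC : ∀ᵐ ξ, ‖σ ξ‖ ≤ C)
    (f : L2) : ∀ᵐ ξ, multiply hσ hC f ξ = σ ξ * f ξ :=
  MemLp.coeFn_toLp _

theorem continuous_multiply {σ : Plane → ℂ} (hσ : AEStronglyMeasurable σ) {C : ℝ}
    (hC : ∀ᵐ ξ, ‖σ ξ‖ ≤ C) : Continuous (multiply hσ hC) := by
  refine LipschitzWith.continuous (K := C.toNNReal) (LipschitzWith.of_dist_le_mul fun f g => ?_)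
  rw [dist_eq_norm, dist_eq_norm]
  refine Lp.norm_le_mul_norm_of_ae_le_mul ?_
  filter_upwards [Lp.coeFn_sub (multiply hσ hC f) (multiply hσ hC g), Lp.coeFn_sub f g,
    multiply_ae hσ hC f, multiply_ae hσ hC g, hC] with ξ h1 h2 h3 h4 h5
  rw [h1, h2, Pi.sub_apply, Pi.sub_apply, h3, h4, ← mul_sub, norm_mul]
  gcongr
  exact h5.trans (Real.le_coe_toNNReal C)

theorem exists_isFiltered {σ : Plane → ℂ} (hσ : AEStronglyMeasurable σ) {C : ℝ}
    (hC : ∀ᵐ ξ, ‖σ ξ‖ ≤ C) (f : L2) : ∃ g : L2, IsFiltered σ f g := by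
  refine ⟨𝓕⁻ (multiply hσ hC (𝓕 f)), ?_⟩
  have : (𝓕 (𝓕⁻ (multiply hσ hC (𝓕 f))) : L2) = multiply hσ hC (𝓕 f) :=
    FourierTransform.fourier_fourierInv_eq _
  rw [IsFiltered, this]
  exact multiply_ae hσ hC _

end Multiplier

section FourierRules

/-! ### Fourier transforms of translates and dilates -/

/-- The phase `ξ ↦ exp (-2πi y·ξ)`. -/
def phase (y ξ : Plane) : ℂ := Complex.exp (-(2 * Real.pi * Complex.I * (inner ℝ y ξ : ℝ)))

theorem norm_phase (y ξ : Plane) : ‖phase y ξ‖ = 1 := by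
  rw [phase, show -(2 * Real.pi * Complex.I * ((inner ℝ y ξ : ℝ) : ℂ))
    = ((-(2 * Real.pi * inner ℝ y ξ) : ℝ) : ℂ) * Complex.I by push_cast; ring]
  exact Complex.norm_exp_ofReal_mul_I _

theorem continuous_phase (y : Plane) : Continuous (phase y) := by
  unfold phase
  fun_prop

theorem fourier_plane_eq (f : Plane → ℂ) (ξ : Plane) :
    𝓕 f ξ = ∫ x, phase x ξ * f x := by
  rw [Real.fourier_eq]
  refine integral_congr_ae (.of_forall fun x => ?_)
  simp only [Circle.smul_def, smul_eq_mul, phase, Real.fourierChar_apply]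
  congr 2
  push_cast
  ring

theorem toLp_ae (g : SchwartzMap Plane ℂ) :
    ∀ᵐ x : Plane, (g.toLp 2 : L2) x = g x := g.coeFn_toLp 2 volume

/-- Both sides are continuous in `f` on `L²`, so it is enough to compare them on Schwartz functions,
where the Fourier transform is an integral. `fourier_dilate` follows the same scheme. -/
theorem fourier_transl (y : Plane) (f : L2) :
    ∀ᵐ ξ, (𝓕 (transl y f) : L2) ξ = phase y ξ * (𝓕 f : L2) ξ := by
  have hb : ∀ᵐ ξ, ‖phase y ξ‖ ≤ 1 := .of_forall fun ξ => (norm_phase y ξ).le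
  have hm : AEStronglyMeasurable (phase y) (volume : Measure Plane) :=
    (continuous_phase y).aestronglyMeasurable
  have key : (𝓕 (transl y f) : L2) = multiply hm hb (𝓕 f) := by
    refine DenseRange.induction_on
      (p := fun f : L2 => (𝓕 (transl y f) : L2) = multiply hm hb (𝓕 f))
      (SchwartzMap.denseRange_toLpCLM (E := Plane) (F := ℂ) (p := 2) ENNReal.ofNat_ne_top) f ?_ ?_
    · refine isClosed_eq ?_ ?_
      · exact (ContinuousFourier.continuous_fourier (E := L2) (F := L2)).comp
          (Lp.isometry_compMeasurePreserving (measurePreserving_sub_right volume y)).continuous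
      · exact (continuous_multiply hm hb).comp
          (ContinuousFourier.continuous_fourier (E := L2) (F := L2))
    · intro g
      rw [SchwartzMap.toLpCLM_apply]
      have h1 : transl y (g.toLp 2) = (g.compSubConstCLM ℂ y).toLp 2 := by
        apply Lp.ext
        filter_upwards [Lp.coeFn_compMeasurePreserving (g.toLp 2)
          (measurePreserving_sub_right volume y), (g.compSubConstCLM ℂ y).coeFn_toLp 2,
          (measurePreserving_sub_right volume y).quasiMeasurePreserving.ae (toLp_ae g)]
          with x h1 h2 h3
        rw [transl, h1, h2, Function.comp_apply, h3]
        rfl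
      rw [h1, SchwartzMap.toLp_fourier_eq, SchwartzMap.toLp_fourier_eq]
      apply Lp.ext
      filter_upwards [(𝓕 (g.compSubConstCLM ℂ y)).coeFn_toLp 2, (𝓕 g).coeFn_toLp 2,
        multiply_ae hm hb ((𝓕 g).toLp 2)] with ξ h1 h2 h3
      rw [h1, h3, h2, SchwartzMap.fourier_coe, SchwartzMap.fourier_coe, fourier_plane_eq,
        fourier_plane_eq, ← integral_const_mul, ← integral_add_right_eq_self _ y]
      refine integral_congr_ae (.of_forall fun x => ?_)
      simp only [SchwartzMap.compSubConstCLM_apply, add_sub_cancel_right, phase, ← mul_assoc,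
        ← Complex.exp_add, inner_add_left]
      congr 2
      push_cast
      ring
  rw [key]
  exact multiply_ae hm hb _

variable {M : Matrix (Fin 2) (Fin 2) ℝ}

theorem dilate_ae (hM : M.det ≠ 0) (f : L2) :
    ∀ᵐ x, dilate M hM f x = ((Real.sqrt |M.det| : ℝ) : ℂ) * f (act M x) :=
  MemLp.coeFn_toLp _

theorem quasiMeasurePreserving_act (hM : M.det ≠ 0) :
    Measure.QuasiMeasurePreserving (act M) (volume : Measure Plane) volume := by
  refine ⟨measurable_act M, ?_⟩
  rw [quasi_act hM]
  exact Measure.smul_absolutelyContinuous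

theorem lintegral_comp_act (hM : M.det ≠ 0) {f : Plane → ℝ≥0∞} (hf : Measurable f) :
    ∫⁻ x, f (act M x) = ENNReal.ofReal |M.det⁻¹| * ∫⁻ x, f x := by
  rw [← lintegral_map hf (measurable_act M), quasi_act hM, lintegral_smul_measure, smul_eq_mul]

theorem integral_comp_act (hM : M.det ≠ 0) {f : Plane → ℂ} (hf : Measurable f) :
    ∫ x, f (act M x) = (|M.det⁻¹| : ℝ) * ∫ x, f x := by
  rw [← integral_map (measurable_act M).aemeasurable hf.aestronglyMeasurable, quasi_act hM,
    integral_smul_measure, ENNReal.toReal_ofReal (abs_nonneg _), Complex.real_smul]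

theorem dilate_sub (hM : M.det ≠ 0) (f g : L2) :
    dilate M hM f - dilate M hM g = dilate M hM (f - g) := by
  apply Lp.ext
  filter_upwards [Lp.coeFn_sub (dilate M hM f) (dilate M hM g), dilate_ae hM f, dilate_ae hM g,
    dilate_ae hM (f - g), (quasiMeasurePreserving_act hM).ae (Lp.coeFn_sub f g)]
    with x h1 h2 h3 h4 h5
  rw [h1, Pi.sub_apply, h2, h3, h4, h5, Pi.sub_apply, mul_sub]

theorem norm_dilate (hM : M.det ≠ 0) (f : L2) : ‖dilate M hM f‖ = ‖f‖ := by
  have h : ‖dilate M hM f‖ₑ ^ 2 = ‖f‖ₑ ^ 2 := by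
    rw [enorm_sq_eq_lintegral, enorm_sq_eq_lintegral]
    have hf : Measurable fun x => ‖f x‖ₑ ^ 2 :=
      (Lp.stronglyMeasurable f).measurable.enorm.pow_const 2
    have h1 : ∫⁻ x, ‖dilate M hM f x‖ₑ ^ 2
        = ENNReal.ofReal |M.det| * ∫⁻ x, ‖f (act M x)‖ₑ ^ 2 := by
      rw [← lintegral_const_mul _ (f := fun x => ‖f (act M x)‖ₑ ^ 2)
        (hf.comp (measurable_act M))]
      refine lintegral_congr_ae ?_
      filter_upwards [dilate_ae hM f] with x hx
      rw [hx, enorm_mul, mul_pow, ← ofReal_norm, ← ENNReal.ofReal_pow (norm_nonneg _)]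
      congr 2
      rw [Complex.norm_real, Real.norm_eq_abs, sq_abs, Real.sq_sqrt (abs_nonneg _)]
    rw [h1, lintegral_comp_act hM hf, ← mul_assoc, ← ENNReal.ofReal_mul (abs_nonneg _),
      ← abs_mul, mul_inv_cancel₀ hM]
    simp
  rw [← toReal_enorm, ← toReal_enorm]
  congr 1
  exact (ENNReal.pow_right_strictMono two_ne_zero).injective h

theorem continuous_dilate (hM : M.det ≠ 0) : Continuous (dilate M hM) := by
  refine LipschitzWith.continuous (K := 1) (LipschitzWith.of_dist_le_mul fun f g => ?_)
  rw [dist_eq_norm, dist_eq_norm, dilate_sub, norm_dilate]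
  simp

theorem inner_act_left (M : Matrix (Fin 2) (Fin 2) ℝ) (x y : Plane) :
    inner ℝ (act M x) y = inner ℝ x (act M.transpose y) := by
  simp only [PiLp.inner_apply, Fin.sum_univ_two, act, Matrix.toLpLin_apply, Matrix.mulVec,
    dotProduct, Matrix.transpose_apply, RCLike.inner_apply, conj_trivial]
  ring

theorem det_transpose_inv_ne_zero (hM : M.det ≠ 0) : M.transpose⁻¹.det ≠ 0 := by
  rw [Matrix.det_nonsing_inv, Matrix.det_transpose, Ring.inverse_eq_inv']
  exact inv_ne_zero hM

/-- `act M` as a continuous linear equivalence. -/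
def actEquiv (hM : M.det ≠ 0) : Plane ≃L[ℝ] Plane :=
  (LinearEquiv.ofBijective (act M)
    ⟨Function.LeftInverse.injective (act_inv_act hM),
      Function.RightInverse.surjective (act_act_inv hM)⟩).toContinuousLinearEquiv

theorem fourier_dilate (hM : M.det ≠ 0) (f : L2) :
    (𝓕 (dilate M hM f) : L2) = dilate M.transpose⁻¹ (det_transpose_inv_ne_zero hM) (𝓕 f) := by
  refine DenseRange.induction_on
    (p := fun f : L2 => (𝓕 (dilate M hM f) : L2)
      = dilate M.transpose⁻¹ (det_transpose_inv_ne_zero hM) (𝓕 f))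
    (SchwartzMap.denseRange_toLpCLM (E := Plane) (F := ℂ) (p := 2) ENNReal.ofNat_ne_top) f ?_ ?_
  · refine isClosed_eq ?_ ?_
    · exact (ContinuousFourier.continuous_fourier (E := L2) (F := L2)).comp (continuous_dilate hM)
    · exact (continuous_dilate _).comp (ContinuousFourier.continuous_fourier (E := L2) (F := L2))
  · intro g
    rw [SchwartzMap.toLpCLM_apply]
    let h : SchwartzMap Plane ℂ := ((Real.sqrt |M.det| : ℝ) : ℂ) •
      SchwartzMap.compCLMOfContinuousLinearEquiv ℂ (actEquiv hM) g
    have hh (x : Plane) : h x = ((Real.sqrt |M.det| : ℝ) : ℂ) * g (act M x) := rfl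
    have h1 : dilate M hM (g.toLp 2) = h.toLp 2 := by
      apply Lp.ext
      filter_upwards [dilate_ae hM (g.toLp 2), h.coeFn_toLp 2,
        (quasiMeasurePreserving_act hM).ae (toLp_ae g)] with x h1 h2 h3
      rw [h1, h2, h3, hh]
    rw [h1, SchwartzMap.toLp_fourier_eq, SchwartzMap.toLp_fourier_eq]
    apply Lp.ext
    have hT := det_transpose_inv_ne_zero hM
    filter_upwards [(𝓕 h).coeFn_toLp 2, (quasiMeasurePreserving_act hT).ae (toLp_ae (𝓕 g)),
      dilate_ae hT ((𝓕 g).toLp 2)] with ξ h1 h2 h3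
    rw [h1, h3, h2, SchwartzMap.fourier_coe, SchwartzMap.fourier_coe, fourier_plane_eq,
      fourier_plane_eq]
    have e1 (x : Plane) : phase x ξ * h x = ((Real.sqrt |M.det| : ℝ) : ℂ)
        * (phase (act M x) (act M.transpose⁻¹ ξ) * g (act M x)) := by
      rw [hh, phase, phase, inner_act_left, act_act_inv (by rwa [Matrix.det_transpose])]
      ring
    simp_rw [e1]
    rw [integral_const_mul, integral_comp_act hM
      (f := fun y => phase y (act M.transpose⁻¹ ξ) * g y), ← mul_assoc, ← Complex.ofReal_mul]
    · congr 2
      rw [Matrix.det_nonsing_inv, Matrix.det_transpose, Ring.inverse_eq_inv', abs_inv,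
        Real.sqrt_inv]
      have hp : 0 < |M.det| := abs_pos.2 hM
      nth_rewrite 2 [← Real.sq_sqrt hp.le]
      have := (Real.sqrt_pos.2 hp).ne'
      field_simp
    · have : Measurable fun y : Plane => phase y (act M.transpose⁻¹ ξ) := by
        have : Continuous fun y : Plane => phase y (act M.transpose⁻¹ ξ) := by
          unfold phase
          fun_prop
        exact this.measurable
      exact this.mul g.continuous.measurable

theorem fourier_packet (f : L2) (i : ScaleRot) (y : Plane) :
    ∀ᵐ ξ, (𝓕 (packet f i y) : L2) ξ = ((Real.sqrt |(matB i).det| : ℝ) : ℂ) *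
      (phase y (act (matB i) ξ) * (𝓕 f : L2) (act (matB i) ξ)) := by
  rw [packet, fourier_dilate]
  have hT := det_transpose_inv_ne_zero (det_matA_ne_zero i)
  filter_upwards [dilate_ae hT (𝓕 (transl y f)),
    (quasiMeasurePreserving_act hT).ae (fourier_transl y f)] with ξ h1 h2
  rw [h1, h2, matB]

end FourierRules

end Wavepacket

end

noncomputable section

namespace Wavepacket

section Counting

/-! ### Uniform bounds for sums over scales and rotations -/

theorem summable_one_div_one_add_sq : Summable fun m : ℤ => 1 / (1 + (m : ℝ) ^ 2) := by
  have h1 : Summable fun m : ℤ => 1 / (m : ℝ) ^ 2 := Real.summable_one_div_int_pow.2 one_lt_two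
  have h2 : Summable fun m : ℤ => if m = 0 then (1 : ℝ) else 0 := (hasSum_ite_eq 0 1).summable
  refine Summable.of_nonneg_of_le (fun m => by positivity) (fun m => ?_) (h1.add h2)
  by_cases hm : m = 0
  · simp [hm]
  · have : (0 : ℝ) < (m : ℝ) ^ 2 := by positivity
    simp only [hm, if_false, add_zero]
    gcongr
    linarith

/-- The bound for the sum over equispaced rotations. -/
def rotationBound : ℝ := ∑' p : ℤ × Bool, 1 / (1 + (p.1 : ℝ) ^ 2)

theorem summable_rotationBound : Summable fun p : ℤ × Bool => 1 / (1 + (p.1 : ℝ) ^ 2) := by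
  have h := summable_one_div_one_add_sq.mul_of_nonneg (f := fun m : ℤ => 1 / (1 + (m : ℝ) ^ 2))
    (g := fun _ : Bool => (1 : ℝ)) (summable_of_hasFiniteSupport (Set.toFinite _))
    (fun m => by positivity) (fun _ => zero_le_one)
  simpa using h

/-- Jordan's inequality gives `|sin πt| ≥ 2 dist(t, ℤ)`. The factor `2` absorbs the rounding: a
nonzero integer nearest to `y` has absolute value at most `2|y|`. -/
theorem sq_le_sq_mul_sin (N : ℕ) (t : ℝ) :
    ((round (N * (t - round t)) : ℤ) : ℝ) ^ 2 ≤ (N * Real.sin (Real.pi * t)) ^ 2 := by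
  have hd : |t - round t| ≤ 1 / 2 := abs_sub_round t
  have hs : |Real.sin (Real.pi * t)| = |Real.sin (Real.pi * (t - round t))| := by
    rw [mul_sub, mul_comm Real.pi ((round t : ℤ) : ℝ), Real.sin_sub_int_mul_pi, abs_mul]
    simp
  have h1 : 2 * |t - round t| ≤ |Real.sin (Real.pi * t)| := by
    have hpi := Real.pi_pos
    rw [hs]
    have := Real.mul_abs_le_abs_sin (x := Real.pi * (t - round t)) (by
      rw [abs_mul, abs_of_pos hpi]; nlinarith)
    rw [abs_mul, abs_of_pos hpi] at this
    calc 2 * |t - round t| = 2 / Real.pi * (Real.pi * |t - round t|) := by field_simp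
      _ ≤ _ := this
  rw [sq_le_sq, abs_mul, Nat.abs_cast]
  set y : ℝ := N * (t - round t) with hy
  have h2 : 2 * |y| ≤ N * |Real.sin (Real.pi * t)| := by
    rw [hy, abs_mul, Nat.abs_cast]
    nlinarith [Nat.cast_nonneg (α := ℝ) N]
  refine le_trans ?_ h2
  have h3 : |y - round y| ≤ 1 / 2 := abs_sub_round y
  have h4 : |((round y : ℤ) : ℝ)| ≤ |y| + 1 / 2 := by
    calc |((round y : ℤ) : ℝ)| = |y - (y - round y)| := by congr 1; ring
      _ ≤ |y| + |y - round y| := abs_sub _ _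
      _ ≤ _ := by linarith
  rcases eq_or_ne (round y) 0 with h0 | h0
  · rw [h0]; simp
  · have h5 : (1 : ℝ) ≤ |((round y : ℤ) : ℝ)| := by
      exact_mod_cast Int.one_le_abs h0
    linarith

/-- The numbers `N sin(φ + 2πk/N)` are spread out like integers, each integer being used at most
twice, so the sum is bounded independently of `N` and `φ`. -/
theorem sum_rotations_le {N : ℕ} (hN : 0 < N) (φ : ℝ) :
    ∑ k : Fin N, 1 / (1 + (N * Real.sin (φ + 2 * (k : ℕ) * Real.pi / N)) ^ 2) ≤ rotationBound := by
  have hN' : (0 : ℝ) < N := by exact_mod_cast hN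
  let t : Fin N → ℝ := fun k => φ / Real.pi + 2 * (k : ℕ) / N
  have ht (k : Fin N) : Real.pi * t k = φ + 2 * (k : ℕ) * Real.pi / N := by
    have := Real.pi_ne_zero
    simp only [t]
    field_simp
  let m : Fin N → ℤ := fun k => round ((N : ℝ) * (t k - round (t k)))
  have hm (k : Fin N) : m k = round (N * (φ / Real.pi)) + 2 * (k : ℕ) - N * round (t k) := by
    have : (N : ℝ) * (t k - round (t k))
        = N * (φ / Real.pi) + ((2 * (k : ℕ) - N * round (t k) : ℤ) : ℝ) := by
      simp only [t]
      push_cast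
      field_simp
      ring
    simp only [m]
    rw [this, round_add_intCast]
    ring
  -- Since `sin²` has period `π`, the angles run through two periods. The Boolean records the half
  -- of the range containing `k`: equal integers force `2(k - l)` to be a multiple of `N`, and
  -- within one half this means `k = l`.
  let ι : Fin N → ℤ × Bool := fun k => (m k, decide (2 * (k : ℕ) < N))
  have hι : Function.Injective ι := by
    intro k l hkl
    simp only [ι, Prod.mk.injEq, decide_eq_decide] at hkl
    obtain ⟨h1, h2⟩ := hkl
    rw [hm, hm] at h1
    have hk := k.2
    have hl := l.2
    have h3 : 2 * ((k : ℕ) : ℤ) - 2 * (l : ℕ) = N * (round (t k) - round (t l)) := by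
      linear_combination h1
    have h4 : |2 * ((k : ℕ) : ℤ) - 2 * (l : ℕ)| < N := by
      rw [abs_lt]
      by_cases h : 2 * (k : ℕ) < N
      · have := h2.1 h; omega
      · have : ¬ 2 * (l : ℕ) < N := fun h' => h (h2.2 h')
        omega
    have h5 : round (t k) - round (t l) = 0 := by
      by_contra h0
      have h6 := Int.one_le_abs h0
      rw [h3, abs_mul, Nat.abs_cast] at h4
      nlinarith
    rw [h5, mul_zero] at h3
    ext
    omega
  calc ∑ k : Fin N, 1 / (1 + (N * Real.sin (φ + 2 * (k : ℕ) * Real.pi / N)) ^ 2)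
      ≤ ∑ k : Fin N, 1 / (1 + ((ι k).1 : ℝ) ^ 2) := by
        refine Finset.sum_le_sum fun k _ => ?_
        have := sq_le_sq_mul_sin N (t k)
        rw [ht k] at this
        gcongr
    _ = ∑ p ∈ Finset.univ.image ι, 1 / (1 + (p.1 : ℝ) ^ 2) :=
        (Finset.sum_image (f := fun p : ℤ × Bool => 1 / (1 + (p.1 : ℝ) ^ 2))
          fun _ _ _ _ h => hι h).symm
    _ ≤ rotationBound := summable_rotationBound.sum_le_tsum _ fun p _ => by positivity

theorem matB_eq (i : ScaleRot) : matB i =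
    !![Real.cos (2 * (i.2 : ℕ) * Real.pi / 2 ^ (i.1 : ℕ)) / 4 ^ (i.1 : ℕ),
        -Real.sin (2 * (i.2 : ℕ) * Real.pi / 2 ^ (i.1 : ℕ)) / 4 ^ (i.1 : ℕ);
      Real.sin (2 * (i.2 : ℕ) * Real.pi / 2 ^ (i.1 : ℕ)) / 2 ^ (i.1 : ℕ),
        Real.cos (2 * (i.2 : ℕ) * Real.pi / 2 ^ (i.1 : ℕ)) / 2 ^ (i.1 : ℕ)] := by
  rw [matB]
  apply Matrix.inv_eq_right_inv
  have h4 : (4 : ℝ) ^ (i.1 : ℕ) ≠ 0 := by positivity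
  have h2 : (2 : ℝ) ^ (i.1 : ℕ) ≠ 0 := by positivity
  have hsc := Real.sin_sq_add_cos_sq (2 * ((i.2 : ℕ) : ℝ) * Real.pi / 2 ^ (i.1 : ℕ))
  rw [matA, rot, parab]
  ext a b
  fin_cases a <;> fin_cases b <;>
    simp [Matrix.mul_apply, Fin.sum_univ_two] <;> field_simp <;> linarith

/-- The radial profile that dominates the sum over the rotations at one scale. -/
def scaleProfile (s ρ : ℝ) : ℝ := min (ρ ^ s) (ρ ^ (-s))

/-- For `ρ ≤ 1` the factor `ρ⁻²` is beaten by the vanishing `ρ^ς`; this is where `ς > 2` matters.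
For `ρ ≥ 1` the denominator supplies the decay `ρ⁻²`. -/
theorem profile_le {ς ρ : ℝ} (hς : 2 < ς) (hρ : 0 < ρ) :
    min 1 (ρ ^ ς) * (max 1 (ρ ^ (-2 : ℝ)) / (1 + ρ ^ 2)) ≤ scaleProfile (min (ς - 2) 2) ρ := by
  set s := min (ς - 2) 2 with hs
  have hs1 : s ≤ ς - 2 := min_le_left _ _
  have hs2 : s ≤ 2 := min_le_right _ _
  have hs0 : 0 < s := lt_min (by linarith) two_pos
  have hp : 0 < ρ ^ 2 := by positivity
  rw [scaleProfile]
  rcases le_total ρ 1 with h | h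
  · have h1 : max 1 (ρ ^ (-2 : ℝ)) = ρ ^ (-2 : ℝ) :=
      max_eq_right (Real.one_le_rpow_of_pos_of_le_one_of_nonpos hρ h (by norm_num))
    have h2 : min 1 (ρ ^ ς) * (max 1 (ρ ^ (-2 : ℝ)) / (1 + ρ ^ 2)) ≤ ρ ^ (ς - 2) := by
      rw [h1, sub_eq_add_neg, Real.rpow_add hρ]
      have h3 : 0 < ρ ^ (-2 : ℝ) := Real.rpow_pos_of_pos hρ _
      gcongr
      · exact min_le_right _ _
      · exact div_le_self h3.le (by linarith)
    refine h2.trans (le_min ?_ ?_)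
    · exact Real.rpow_le_rpow_of_exponent_ge hρ h hs1
    · exact Real.rpow_le_rpow_of_exponent_ge hρ h (by linarith)
  · have h1 : max 1 (ρ ^ (-2 : ℝ)) = 1 :=
      max_eq_left (Real.rpow_le_one_of_one_le_of_nonpos h (by norm_num))
    have h2 : min 1 (ρ ^ ς) * (max 1 (ρ ^ (-2 : ℝ)) / (1 + ρ ^ 2)) ≤ ρ ^ (-2 : ℝ) := by
      rw [h1, Real.rpow_neg hρ.le, ← one_div, Real.rpow_two]
      calc min 1 (ρ ^ ς) * (1 / (1 + ρ ^ 2)) ≤ 1 * (1 / ρ ^ 2) := by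
            gcongr
            · exact min_le_left _ _
            · linarith
        _ = _ := one_mul _
    refine h2.trans (le_min ?_ ?_)
    · exact Real.rpow_le_rpow_of_exponent_le h (by linarith)
    · exact Real.rpow_le_rpow_of_exponent_le h (by linarith)

/-- The bound for the sum of `scaleProfile` over dyadic scales. -/
def scaleBound (s : ℝ) : ℝ≥0∞ := ∑' z : ℤ, ENNReal.ofReal ((4 : ℝ) ^ s * ((4 : ℝ) ^ (-s)) ^ z.natAbs)

theorem scaleBound_lt_top {s : ℝ} (hs : 0 < s) : scaleBound s < ⊤ := by
  have hq0 : 0 < (4 : ℝ) ^ (-s) := by positivity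
  have hq1 : (4 : ℝ) ^ (-s) < 1 := Real.rpow_lt_one_of_one_lt_of_neg (by norm_num) (by linarith)
  have hg := summable_geometric_of_lt_one hq0.le hq1
  have : Summable fun z : ℤ => (4 : ℝ) ^ s * ((4 : ℝ) ^ (-s)) ^ z.natAbs := by
    refine Summable.mul_left _ (Summable.of_nat_of_neg ?_ ?_)
    · simpa using hg
    · simpa using hg
  rw [scaleBound, ← ENNReal.ofReal_tsum_of_nonneg (fun z => by positivity) this]
  exact ENNReal.ofReal_lt_top

/-- Writing `r = 4^t`, the terms decay geometrically in `|j - ⌊t⌋|`. The factor `4^s` in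
`scaleBound` pays for the fractional part of `t`, and extending the sum to all integers removes the
dependence on `r`. -/
theorem tsum_scaleProfile_le {s r : ℝ} (hs : 0 < s) (hr : 0 < r) :
    ∑' j : ℕ+, ENNReal.ofReal (scaleProfile s (r / 4 ^ (j : ℕ))) ≤ scaleBound s := by
  let t := Real.logb 4 r
  have hrt : r = (4 : ℝ) ^ t := (Real.rpow_logb (by norm_num) (by norm_num) hr).symm
  have hρ (j : ℕ) : r / 4 ^ j = (4 : ℝ) ^ (t - j) := by
    rw [Real.rpow_sub (by norm_num), ← hrt, Real.rpow_natCast]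
  have hi : Function.Injective fun j : ℕ+ => (((j : ℕ) : ℤ) - ⌊t⌋) := by
    intro j l h
    have : ((j : ℕ) : ℤ) = (l : ℕ) := by simpa using h
    exact_mod_cast this
  refine le_trans (ENNReal.tsum_le_tsum fun j => ?_) (ENNReal.tsum_comp_le_tsum_of_injective hi
    fun z : ℤ => ENNReal.ofReal ((4 : ℝ) ^ s * ((4 : ℝ) ^ (-s)) ^ z.natAbs))
  apply ENNReal.ofReal_le_ofReal
  rw [hρ, scaleProfile, ← Real.rpow_natCast, ← Real.rpow_mul (by norm_num), ← Real.rpow_mul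
    (by norm_num), ← Real.rpow_mul (by norm_num), ← Real.rpow_add (by norm_num)]
  have h1 := Int.floor_le t
  have h2 := Int.lt_floor_add_one t
  have h3 : ((((j : ℕ) : ℤ) - ⌊t⌋).natAbs : ℝ) = |((j : ℕ) : ℝ) - ⌊t⌋| := by
    rw [Nat.cast_natAbs]; push_cast; rfl
  rw [h3]
  rcases le_total 0 (((j : ℕ) : ℝ) - ⌊t⌋) with h | h
  · rw [abs_of_nonneg h]
    refine (min_le_left _ _).trans (Real.rpow_le_rpow_of_exponent_le (by norm_num) ?_)
    nlinarith
  · rw [abs_of_nonpos h]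
    refine (min_le_right _ _).trans (Real.rpow_le_rpow_of_exponent_le (by norm_num) ?_)
    nlinarith

theorem norm_sq_plane (u : Plane) : ‖u‖ ^ 2 = u 0 ^ 2 + u 1 ^ 2 := by
  rw [EuclideanSpace.norm_sq_eq, Fin.sum_univ_two, Real.norm_eq_abs, Real.norm_eq_abs, sq_abs,
    sq_abs]

theorem exp_neg_le {c q x y : ℝ} (hc : 0 < c) (hx : 0 ≤ x) (hxq : x ≤ q) (hy : 0 ≤ y)
    (hyq : y ≤ q) :
    Real.exp (-c * q) ≤ 1 / min 1 (c / 2) ^ 2 * (1 / (1 + x) * (1 / (1 + y))) := by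
  set m := min 1 (c / 2) with hm
  have hm0 : 0 < m := lt_min one_pos (by linarith)
  have h1 : m * (1 + q) ≤ 1 + c * q / 2 := by
    have h2 : m ≤ 1 := min_le_left _ _
    have h3 : m ≤ c / 2 := min_le_right _ _
    nlinarith
  have h4 : 1 + c * q / 2 ≤ Real.exp (c * q / 2) := by
    linarith [Real.add_one_le_exp (c * q / 2)]
  have h5 : m ^ 2 * ((1 + x) * (1 + y)) ≤ Real.exp (c * q) := by
    calc m ^ 2 * ((1 + x) * (1 + y)) ≤ m ^ 2 * ((1 + q) * (1 + q)) := by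
          have : 0 ≤ q := hx.trans hxq
          gcongr
      _ = (m * (1 + q)) ^ 2 := by ring
      _ ≤ Real.exp (c * q / 2) ^ 2 := by
        have : 0 ≤ m * (1 + q) := by
          have : 0 ≤ q := hx.trans hxq
          positivity
        gcongr
        linarith
      _ = Real.exp (c * q) := by
        rw [← Real.exp_nat_mul]; congr 1; push_cast; ring
  rw [neg_mul, Real.exp_neg]
  rw [show 1 / m ^ 2 * (1 / (1 + x) * (1 / (1 + y))) = (m ^ 2 * ((1 + x) * (1 + y)))⁻¹ by
    field_simp]
  exact inv_anti₀ (by positivity) h5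

/-- The decay profile of the square of the window `φ̂`. -/
def windowProfile (ς c : ℝ) (u : Plane) : ℝ := min 1 (|u 0| ^ ς) * Real.exp (-c * ‖u‖ ^ 2)

/-- A bound for the sum of `windowProfile` over all scales and rotations. -/
def profileBound (ς c : ℝ) : ℝ≥0∞ :=
  ENNReal.ofReal (1 / min 1 (c / 2) ^ 2 * rotationBound) * scaleBound (min (ς - 2) 2)

theorem exists_polar (ξ : Plane) :
    ∃ α : ℝ, ξ 0 = ‖ξ‖ * Real.cos α ∧ ξ 1 = ‖ξ‖ * Real.sin α := by
  let z : ℂ := ⟨ξ 0, ξ 1⟩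
  have hz : ‖z‖ = ‖ξ‖ := by
    have : ‖z‖ ^ 2 = ‖ξ‖ ^ 2 := by
      rw [norm_sq_plane, ← Complex.normSq_eq_norm_sq, Complex.normSq_apply]
      ring
    exact (sq_eq_sq₀ (norm_nonneg _) (norm_nonneg _)).1 this
  refine ⟨z.arg, ?_, ?_⟩
  · rw [← hz, Complex.norm_mul_cos_arg]
  · rw [← hz, Complex.norm_mul_sin_arg]

/-- With `N = 2^j` and `ρ = |ξ|/4^j`, the point `B ξ` has coordinates `ρ cos` and `ρ N sin` of the
rotated angle. The Gaussian is split into a factor decaying in `ρ`, to be summed over scales, and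
one decaying in `N sin`, to be summed over rotations. -/
theorem windowProfile_matB_le {ς c : ℝ} (hς : 2 < ς) (hc : 0 < c) {ξ : Plane} (hξ : ξ ≠ 0)
    {α : ℝ} (h0 : ξ 0 = ‖ξ‖ * Real.cos α) (h1 : ξ 1 = ‖ξ‖ * Real.sin α) (i : ScaleRot) :
    windowProfile ς c (act (matB i) ξ) ≤
      1 / min 1 (c / 2) ^ 2 * scaleProfile (min (ς - 2) 2) (‖ξ‖ / 4 ^ (i.1 : ℕ)) *
        (1 / (1 + (((2 ^ (i.1 : ℕ) : ℕ) : ℝ) *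
          Real.sin (α + 2 * (i.2 : ℕ) * Real.pi / (2 ^ (i.1 : ℕ) : ℕ))) ^ 2)) := by
  have hr : 0 < ‖ξ‖ := norm_pos_iff.2 hξ
  set r := ‖ξ‖
  set N : ℝ := 2 ^ (i.1 : ℕ) with hN
  have hN1 : 1 ≤ N := one_le_pow₀ one_le_two
  have h4 : (4 : ℝ) ^ (i.1 : ℕ) = N * N := by rw [hN, ← mul_pow]; norm_num
  push_cast
  rw [← hN]
  set θ := 2 * ((i.2 : ℕ) : ℝ) * Real.pi / N with hθ
  set ρ := r / 4 ^ (i.1 : ℕ) with hρ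
  have hρ0 : 0 < ρ := by positivity
  set u := act (matB i) ξ with hu
  have hu0 : u 0 = ρ * Real.cos (α + θ) := by
    rw [hu, matB_eq]
    simp only [act, Matrix.toLpLin_apply, Matrix.mulVec, dotProduct, Fin.sum_univ_two,
      Matrix.of_apply, Matrix.cons_val_zero, Matrix.cons_val_one, Matrix.cons_val_fin_one]
    rw [h0, h1, ← hN, ← hθ, Real.cos_add, hρ]
    ring
  have hu1 : u 1 = ρ * (N * Real.sin (α + θ)) := by
    rw [hu, matB_eq]
    simp only [act, Matrix.toLpLin_apply, Matrix.mulVec, dotProduct, Fin.sum_univ_two,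
      Matrix.of_apply, Matrix.cons_val_zero, Matrix.cons_val_one, Matrix.cons_val_fin_one]
    rw [h0, h1, ← hN, ← hθ, Real.sin_add, hρ, h4]
    field_simp
    ring
  set w := (N * Real.sin (α + θ)) ^ 2 with hw
  have hw0 : 0 ≤ w := sq_nonneg _
  have hq : ‖u‖ ^ 2 = ρ ^ 2 * Real.cos (α + θ) ^ 2 + ρ ^ 2 * w := by
    rw [norm_sq_plane, hu0, hu1, hw]; ring
  have hq1 : ρ ^ 2 ≤ ‖u‖ ^ 2 := by
    have hsw : Real.sin (α + θ) ^ 2 ≤ w := by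
      rw [hw, mul_pow]
      exact le_mul_of_one_le_left (sq_nonneg _) (one_le_pow₀ hN1)
    have := Real.sin_sq_add_cos_sq (α + θ)
    rw [hq]
    nlinarith [sq_nonneg ρ]
  have hq2 : ρ ^ 2 * w ≤ ‖u‖ ^ 2 := by
    rw [hq]
    exact le_add_of_nonneg_left (by positivity)
  have hmin : min 1 (|u 0| ^ ς) ≤ min 1 (ρ ^ ς) := by
    have hab : |u 0| ≤ ρ := by
      rw [hu0, abs_mul, abs_of_pos hρ0]
      exact mul_le_of_le_one_right hρ0.le (Real.abs_cos_le_one _)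
    gcongr
  have hexp := exp_neg_le hc (sq_nonneg ρ) hq1 (by positivity) hq2
  -- The angular factor is freed from `ρ` at the price of `max(1, ρ⁻²)`, which is the loss of two
  -- powers compensated in `profile_le`.
  have hden : 1 / (1 + ρ ^ 2 * w) ≤ max 1 (ρ ^ (-2 : ℝ)) * (1 / (1 + w)) := by
    have hm1 : 1 ≤ max 1 (ρ ^ (-2 : ℝ)) := le_max_left _ _
    have hm2 : 1 ≤ max 1 (ρ ^ (-2 : ℝ)) * ρ ^ 2 := by
      calc (1 : ℝ) = ρ ^ (-2 : ℝ) * ρ ^ 2 := by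
            rw [Real.rpow_neg hρ0.le, Real.rpow_two]; field_simp
        _ ≤ _ := by gcongr; exact le_max_right _ _
    rw [mul_one_div, div_le_div_iff₀ (by positivity) (by positivity)]
    nlinarith
  rw [windowProfile]
  set K := 1 / min 1 (c / 2) ^ 2
  have hK : 0 ≤ K := by positivity
  have hmp : 0 ≤ min 1 (ρ ^ ς) := by positivity
  calc min 1 (|u 0| ^ ς) * Real.exp (-c * ‖u‖ ^ 2)
      ≤ min 1 (ρ ^ ς) * (K * (1 / (1 + ρ ^ 2) * (1 / (1 + ρ ^ 2 * w)))) := by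
        gcongr
    _ ≤ min 1 (ρ ^ ς) * (K * (1 / (1 + ρ ^ 2) * (max 1 (ρ ^ (-2 : ℝ)) * (1 / (1 + w))))) := by
        gcongr
    _ = K * (min 1 (ρ ^ ς) * (max 1 (ρ ^ (-2 : ℝ)) / (1 + ρ ^ 2))) * (1 / (1 + w)) := by
        ring
    _ ≤ K * scaleProfile (min (ς - 2) 2) ρ * (1 / (1 + w)) := by
        gcongr
        exact profile_le hς hρ0

theorem tsum_windowProfile_le {ς c : ℝ} (hς : 2 < ς) (hc : 0 < c) (ξ : Plane) :
    ∑' i : ScaleRot, ENNReal.ofReal (windowProfile ς c (act (matB i) ξ)) ≤ profileBound ς c := by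
  by_cases hξ : ξ = 0
  · have : ∀ i : ScaleRot, windowProfile ς c (act (matB i) ξ) = 0 := fun i => by
      rw [hξ, map_zero, windowProfile]
      simp [Real.zero_rpow (by linarith : ς ≠ 0)]
    simp [this]
  obtain ⟨α, h0, h1⟩ := exists_polar ξ
  have hs : 0 < min (ς - 2) 2 := lt_min (by linarith) two_pos
  have hr : 0 < ‖ξ‖ := norm_pos_iff.2 hξ
  set K := 1 / min 1 (c / 2) ^ 2 with hK
  have hK0 : 0 ≤ K := by positivity
  have hp0 (j : ℕ+) : 0 ≤ scaleProfile (min (ς - 2) 2) (‖ξ‖ / 4 ^ (j : ℕ)) := by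
    rw [scaleProfile]; positivity
  rw [ENNReal.tsum_sigma']
  calc ∑' (j : ℕ+) (k : Fin (2 ^ (j : ℕ))),
        ENNReal.ofReal (windowProfile ς c (act (matB ⟨j, k⟩) ξ))
      ≤ ∑' j : ℕ+, ENNReal.ofReal (K * rotationBound) *
          ENNReal.ofReal (scaleProfile (min (ς - 2) 2) (‖ξ‖ / 4 ^ (j : ℕ))) := by
        refine ENNReal.tsum_le_tsum fun j => ?_
        have hrot : 0 ≤ rotationBound := tsum_nonneg fun p => by positivity
        rw [tsum_fintype, ← ENNReal.ofReal_mul (by positivity),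
          ← ENNReal.ofReal_sum_of_nonneg fun k _ => by rw [windowProfile]; positivity]
        apply ENNReal.ofReal_le_ofReal
        refine (Finset.sum_le_sum fun k _ =>
          windowProfile_matB_le hς hc hξ h0 h1 ⟨j, k⟩).trans ?_
        dsimp only
        rw [← Finset.mul_sum]
        have := sum_rotations_le (N := 2 ^ (j : ℕ)) (by positivity) α
        exact (mul_le_mul_of_nonneg_left this (mul_nonneg hK0 (hp0 j))).trans_eq (by ring)
    _ ≤ profileBound ς c := by
        rw [ENNReal.tsum_mul_left, profileBound]
        gcongr
        exact tsum_scaleProfile_le hs hr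

theorem profileBound_lt_top {ς c : ℝ} (hς : 2 < ς) : profileBound ς c < ⊤ :=
  ENNReal.mul_lt_top ENNReal.ofReal_lt_top
    (scaleBound_lt_top (lt_min (by linarith) two_pos))

end Counting

end Wavepacket

end

noncomputable section

namespace Wavepacket

section Decay

/-! ### Gaussian decay of the correlation function and of the lattice sum -/

theorem det_matB_ne_zero (i : ScaleRot) : (matB i).det ≠ 0 :=
  det_transpose_inv_ne_zero (det_matA_ne_zero i)

theorem quasiMeasurePreserving_matB (i : ScaleRot) :
    Measure.QuasiMeasurePreserving (act (matB i)) (volume : Measure Plane) volume :=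
  quasiMeasurePreserving_act (det_matB_ne_zero i)

/-- The constant in the Gaussian bound for the correlation function. -/
def corrBound (δ ς C₀ : ℝ) : ℝ≥0∞ := ENNReal.ofReal (C₀ ^ 2) * (1 + profileBound ς (δ / 2))

theorem corrBound_lt_top {δ ς C₀ : ℝ} (hς : 2 < ς) : corrBound δ ς C₀ < ⊤ :=
  ENNReal.mul_lt_top ENNReal.ofReal_lt_top
    (ENNReal.add_lt_top.2 ⟨ENNReal.one_lt_top, profileBound_lt_top hς⟩)

/-- By the parallelogram bound `|ζ|² ≤ 2(|u|² + |u - ζ|²)`, half of the total exponent yields the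
decay in `ζ`, while half of the first Gaussian survives for the sum over scales. -/
theorem gaussian_mul_le {δ : ℝ} (hδ : 0 < δ) (u ζ : Plane) :
    Real.exp (-δ * ‖u‖ ^ 2) * Real.exp (-δ * ‖u - ζ‖ ^ 2)
      ≤ Real.exp (-(δ / 2) * ‖u‖ ^ 2) * Real.exp (-(δ / 4) * ‖ζ‖ ^ 2) := by
  rw [← Real.exp_add, ← Real.exp_add]
  apply Real.exp_le_exp.2
  have h : ‖ζ‖ ≤ ‖u‖ + ‖u - ζ‖ := by
    calc ‖ζ‖ = ‖u - (u - ζ)‖ := by congr 1; abel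
      _ ≤ _ := norm_sub_le _ _
  have h1 : ‖ζ‖ ^ 2 ≤ 2 * (‖u‖ ^ 2 + ‖u - ζ‖ ^ 2) := by
    nlinarith [sq_nonneg (‖u‖ - ‖u - ζ‖), norm_nonneg ζ]
  nlinarith [sq_nonneg ‖u - ζ‖]

theorem enorm_mul_enorm_le {C₀ p q r : ℝ} {z w : ℂ} (hz : ‖z‖ ≤ C₀ * p)
    (hw : ‖w‖ ≤ C₀ * q) (hpq : p * q ≤ r) :
    ‖z‖ₑ * ‖w‖ₑ ≤ ENNReal.ofReal (C₀ ^ 2) * ENNReal.ofReal r := by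
  rw [← ofReal_norm, ← ofReal_norm, ← ENNReal.ofReal_mul (norm_nonneg _),
    ← ENNReal.ofReal_mul (sq_nonneg _)]
  apply ENNReal.ofReal_le_ofReal
  calc ‖z‖ * ‖w‖ ≤ (C₀ * p) * (C₀ * q) :=
        mul_le_mul hz hw (norm_nonneg _) ((norm_nonneg _).trans hz)
    _ = C₀ ^ 2 * (p * q) := by ring
    _ ≤ C₀ ^ 2 * r := by gcongr

variable {δ ς C₀ A B : ℝ} {φ₀ φ : L2}

/-- Only the unshifted window keeps its vanishing factor; that of the shifted window is bounded by
one. What remains is the profile with `δ/2`, whose sum over scales and rotations is uniformly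
bounded. -/
theorem corr_le (hδ : 0 < δ) (hς : 2 < ς) (h : AdmissibleWindows δ ς C₀ A B φ₀ φ) (ζ : Plane) :
    corr φ₀ φ ζ ≤ corrBound δ ς C₀ * ENNReal.ofReal (Real.exp (-(δ / 4) * ‖ζ‖ ^ 2)) := by
  have hshift := (measurePreserving_sub_right (volume : Measure Plane) ζ).quasiMeasurePreserving
  refine essSup_le_of_ae_le _ ?_
  have h1 : ∀ᵐ ξ : Plane, ∀ i : ScaleRot, ‖(𝓕 φ : L2) (act (matB i) ξ)‖
      ≤ C₀ * (min 1 (|(act (matB i) ξ) 0| ^ ς) * Real.exp (-δ * ‖act (matB i) ξ‖ ^ 2)) :=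
    ae_all_iff.2 fun i => (quasiMeasurePreserving_matB i).ae h.decay_fine
  have h2 : ∀ᵐ ξ : Plane, ∀ i : ScaleRot, ‖(𝓕 φ : L2) (act (matB i) ξ - ζ)‖
      ≤ C₀ * (min 1 (|(act (matB i) ξ - ζ) 0| ^ ς) * Real.exp (-δ * ‖act (matB i) ξ - ζ‖ ^ 2)) :=
    ae_all_iff.2 fun i => (quasiMeasurePreserving_matB i).ae (hshift.ae h.decay_fine)
  filter_upwards [h.decay_coarse, hshift.ae h.decay_coarse, h1, h2] with ξ c1 c2 f1 f2
  rw [corrBound, mul_add, mul_one, add_mul]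
  refine add_le_add ?_ ?_
  · refine enorm_mul_enorm_le c1 c2 ((gaussian_mul_le hδ ξ ζ).trans ?_)
    refine mul_le_of_le_one_left (Real.exp_nonneg _) (Real.exp_le_one_iff.2 ?_)
    nlinarith [sq_nonneg ‖ξ‖]
  · rw [mul_right_comm]
    refine le_trans ?_ (mul_le_mul_right (tsum_windowProfile_le hς (half_pos hδ) ξ) _)
    rw [← ENNReal.tsum_mul_left]
    refine ENNReal.tsum_le_tsum fun i => ?_
    rw [mul_assoc, ← ENNReal.ofReal_mul (Real.exp_nonneg _)]
    refine enorm_mul_enorm_le (f1 i) (f2 i) ?_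
    set u := act (matB i) ξ
    set a := min 1 (|u 0| ^ ς)
    set b := min 1 (|(u - ζ) 0| ^ ς)
    have ha : 0 ≤ a := by positivity
    have hb : b ≤ 1 := min_le_left _ _
    have hb0 : 0 ≤ b := by positivity
    calc a * Real.exp (-δ * ‖u‖ ^ 2) * (b * Real.exp (-δ * ‖u - ζ‖ ^ 2))
        = a * b * (Real.exp (-δ * ‖u‖ ^ 2) * Real.exp (-δ * ‖u - ζ‖ ^ 2)) := by ring
      _ ≤ a * 1 * (Real.exp (-(δ / 2) * ‖u‖ ^ 2) * Real.exp (-(δ / 4) * ‖ζ‖ ^ 2)) := by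
        exact mul_le_mul (mul_le_mul_of_nonneg_left hb ha) (gaussian_mul_le hδ u ζ)
          (by positivity) (by positivity)
      _ = Real.exp (-(δ / 4) * ‖ζ‖ ^ 2) * windowProfile ς (δ / 2) u := by
        rw [windowProfile]; ring

theorem coverSum_le_corr (φ₀ φ : L2) : ∀ᵐ ξ : Plane, coverSum φ₀ φ ξ ≤ corr φ₀ φ 0 := by
  rw [corr]
  simp only [sub_zero, ← sq]
  exact ENNReal.ae_le_essSup _

/-- The covering sum is the integrand of `Θ(0)`, so `A ≤ Θ(0)`. This makes it possible to trade `A`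
for a constant depending only on `δ, ς, C₀`. -/
theorem ofReal_le_corrBound (hδ : 0 < δ) (hς : 2 < ς) (h : AdmissibleWindows δ ς C₀ A B φ₀ φ) :
    ENNReal.ofReal A ≤ corrBound δ ς C₀ := by
  obtain ⟨ξ, h1, h2⟩ := (h.cover.and (coverSum_le_corr φ₀ φ)).exists
  have := corr_le hδ hς h 0
  simp only [norm_zero, ne_eq, OfNat.ofNat_ne_zero, not_false_eq_true, zero_pow, mul_zero,
    Real.exp_zero, ENNReal.ofReal_one, mul_one] at this
  exact h1.1.trans (h2.trans this)

/-- Expand in an eigenbasis of `T*T`, whose eigenvalues are the squared singular values. -/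
theorem norm_act_le (P : Matrix (Fin 2) (Fin 2) ℝ) (v : Plane) :
    ‖act P v‖ ≤ (act P).singularValues 0 * ‖v‖ := by
  set T := act P
  set a := T.singularValues 0 with ha
  have ha0 : 0 ≤ a := T.singularValues_nonneg 0
  have hfr : Module.finrank ℝ Plane = 2 := by simp
  let S := T.isSymmetric_adjoint_comp_self
  let b := S.eigenvectorBasis hfr
  have h1 : ‖T v‖ ^ 2 = inner ℝ ((LinearMap.adjoint T ∘ₗ T) v) v := by
    rw [LinearMap.comp_apply, LinearMap.adjoint_inner_left, real_inner_self_eq_norm_sq]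
  have h2 : inner ℝ ((LinearMap.adjoint T ∘ₗ T) v) v
      = ∑ i : Fin 2, S.eigenvalues hfr i * (b.repr v i) ^ 2 := by
    rw [← b.repr.inner_map_map, PiLp.inner_apply]
    refine Finset.sum_congr rfl fun i _ => ?_
    rw [S.eigenvectorBasis_apply_self_apply hfr]
    simp only [RCLike.inner_apply, conj_trivial]
    simp only [RCLike.ofReal_real_eq_id, id_eq]
    ring
  have h3 : ‖v‖ ^ 2 = ∑ i : Fin 2, (b.repr v i) ^ 2 := by
    rw [← b.repr.norm_map, EuclideanSpace.norm_sq_eq]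
    simp
  have h4 : ‖T v‖ ^ 2 ≤ (a * ‖v‖) ^ 2 := by
    rw [h1, h2, mul_pow, h3, Finset.mul_sum]
    refine Finset.sum_le_sum fun i _ => ?_
    have h5 : S.eigenvalues hfr i ≤ a ^ 2 := by
      rw [← T.sq_singularValues_fin hfr i]
      have := T.singularValues_antitone (Nat.zero_le (i : ℕ))
      have := T.singularValues_nonneg i
      gcongr
    gcongr
  exact le_of_sq_le_sq h4 (by positivity)

/-- Since `Pᵀγ = n`, one has `|n|² = ⟨P n, γ⟩ ≤ a |n| |γ|`. -/
theorem norm_latVec_le {P : Matrix (Fin 2) (Fin 2) ℝ} (hP : P.det ≠ 0) (n : Fin 2 → ℤ) :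
    ‖latVec n‖ ≤ (act P).singularValues 0 * ‖act P⁻¹.transpose (latVec n)‖ := by
  set γ := act P⁻¹.transpose (latVec n) with hγ
  have h1 : act P.transpose γ = latVec n := by
    rw [hγ, Matrix.transpose_nonsing_inv, act_act_inv (by rwa [Matrix.det_transpose])]
  have h2 : ‖latVec n‖ ^ 2 = inner ℝ (act P (latVec n)) γ := by
    rw [inner_act_left, h1, real_inner_self_eq_norm_sq]
  have h3 := (real_inner_le_norm (act P (latVec n)) γ).trans
    (mul_le_mul_of_nonneg_right (norm_act_le P (latVec n)) (norm_nonneg γ))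
  rw [← h2] at h3
  rcases (norm_nonneg (latVec n)).eq_or_lt with h | h
  · rw [← h]
    exact mul_nonneg ((act P).singularValues_nonneg 0) (norm_nonneg _)
  · by_contra hc
    nlinarith

theorem one_le_norm_latVec_sq {n : Fin 2 → ℤ} (hn : n ≠ 0) : 1 ≤ ‖latVec n‖ ^ 2 := by
  rw [norm_sq_plane]
  simp only [latVec, intVec]
  have : 0 < n 0 ^ 2 + n 1 ^ 2 := by
    by_contra hc
    apply hn
    have h0 : n 0 = 0 := by nlinarith [sq_nonneg (n 0), sq_nonneg (n 1)]
    have h1 : n 1 = 0 := by nlinarith [sq_nonneg (n 0), sq_nonneg (n 1)]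
    ext i
    fin_cases i <;> simp [h0, h1]
  exact_mod_cast this

/-- The Gaussian sum over the integer lattice. -/
def gaussSum (c : ℝ) : ℝ≥0∞ :=
  ∑' n : Fin 2 → ℤ, ENNReal.ofReal (Real.exp (-c * ‖latVec n‖ ^ 2))

theorem gaussSum_lt_top {c : ℝ} (hc : 0 < c) : gaussSum c < ⊤ := by
  have h1 : ∑' m : ℤ, ENNReal.ofReal (Real.exp (-c * (m : ℝ) ^ 2)) < ⊤ := by
    have hs : Summable fun m : ℤ => Real.exp (-c * (m : ℝ) ^ 2) := by
      refine Summable.of_nonneg_of_le (fun m => Real.exp_nonneg _) (fun m => ?_)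
        (summable_one_div_one_add_sq.mul_left (1 / min 1 (c / 2) ^ 2))
      have := exp_neg_le hc (sq_nonneg (m : ℝ)) le_rfl le_rfl (sq_nonneg (m : ℝ))
      simpa using this
    rw [← ENNReal.ofReal_tsum_of_nonneg (fun m => Real.exp_nonneg _) hs]
    exact ENNReal.ofReal_lt_top
  have h2 : gaussSum c = (∑' m : ℤ, ENNReal.ofReal (Real.exp (-c * (m : ℝ) ^ 2)))
      * ∑' m : ℤ, ENNReal.ofReal (Real.exp (-c * (m : ℝ) ^ 2)) := by
    rw [gaussSum, ← (finTwoArrowEquiv ℤ).symm.tsum_eq, ENNReal.tsum_prod']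
    simp_rw [← ENNReal.tsum_mul_right, ← ENNReal.tsum_mul_left]
    refine tsum_congr fun m => tsum_congr fun l => ?_
    rw [← ENNReal.ofReal_mul (Real.exp_nonneg _), ← Real.exp_add, norm_sq_plane]
    have e0 : latVec ((finTwoArrowEquiv ℤ).symm (m, l)) 0 = m := rfl
    have e1 : latVec ((finTwoArrowEquiv ℤ).symm (m, l)) 1 = l := rfl
    rw [e0, e1]
    congr 2
    ring
  rw [h2]
  exact ENNReal.mul_lt_top h1 h1

theorem latVec_injective : Function.Injective latVec := by
  intro n m h
  ext i
  have := congrArg (fun v : Plane => v i) h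
  simpa [latVec, intVec] using this

theorem act_injective {M : Matrix (Fin 2) (Fin 2) ℝ} (hM : M.det ≠ 0) :
    Function.Injective (act M) := Function.LeftInverse.injective (act_inv_act hM)

/-- The lattice `P ℤ²` is indexed by `ℤ²`. -/
def latticeEquiv {P : Matrix (Fin 2) (Fin 2) ℝ} (hP : P.det ≠ 0) : (Fin 2 → ℤ) ≃ lattice P :=
  Equiv.ofInjective (fun n => act P (latVec n)) ((act_injective hP).comp latVec_injective)

theorem det_inv_transpose_ne_zero {P : Matrix (Fin 2) (Fin 2) ℝ} (hP : P.det ≠ 0) :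
    P⁻¹.transpose.det ≠ 0 := by
  rw [Matrix.transpose_nonsing_inv]
  exact det_transpose_inv_ne_zero hP

/-- The nonzero points of the dual lattice of `P ℤ²` are indexed by the nonzero points of `ℤ²`. -/
def dualEquiv {P : Matrix (Fin 2) (Fin 2) ℝ} (hP : P.det ≠ 0) :
    {n : Fin 2 → ℤ // n ≠ 0} ≃ ↥(dualLattice P \ {0}) :=
  Equiv.ofBijective (fun n => ⟨act P⁻¹.transpose (latVec n.1), ⟨n.1, rfl⟩, fun h => n.2 (by
      have h0 : act P⁻¹.transpose (latVec n.1) = act P⁻¹.transpose (latVec 0) := by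
        rw [show latVec 0 = 0 by rw [latVec, intVec_zero]; rfl, map_zero]; exact h
      exact latVec_injective (act_injective (det_inv_transpose_ne_zero hP) h0))⟩)
    ⟨fun n m h => Subtype.ext (latVec_injective (act_injective (det_inv_transpose_ne_zero hP)
        (congrArg Subtype.val h))), by
      rintro ⟨_, ⟨n, rfl⟩, h⟩
      refine ⟨⟨n, ?_⟩, rfl⟩
      rintro rfl
      apply h
      change act P⁻¹.transpose (latVec 0) = 0
      rw [show latVec 0 = 0 by rw [latVec, intVec_zero]; rfl, map_zero]⟩

theorem latticeDelta_eq {P : Matrix (Fin 2) (Fin 2) ℝ} (hP : P.det ≠ 0) (φ₀ φ : L2) :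
    latticeDelta φ₀ φ P = ∑' n : {n : Fin 2 → ℤ // n ≠ 0},
      max (corr φ₀ φ (act P⁻¹.transpose (latVec n))) (corr φ₀ φ (-act P⁻¹.transpose (latVec n))) := by
  rw [latticeDelta, ← (dualEquiv hP).tsum_eq]
  rfl

/-- The exponent `δ|γ|²/4` is cut into two halves: `|γ|² ≥ 1/a²` gives the decay, and `|γ|² ≥ |n|²`,
valid as `a ≤ 1`, gives a convergent Gaussian sum independent of `P`. -/
theorem latticeDelta_le_of_le_one (hδ : 0 < δ) (hς : 2 < ς)
    (h : AdmissibleWindows δ ς C₀ A B φ₀ φ) {P : Matrix (Fin 2) (Fin 2) ℝ} (hP : P.det ≠ 0)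
    (ha : (act P).singularValues 0 ≤ 1) :
    latticeDelta φ₀ φ P ≤ corrBound δ ς C₀ * gaussSum (δ / 8) *
      ENNReal.ofReal (Real.exp (-(δ / 8) / (act P).singularValues 0 ^ 2)) := by
  set a := (act P).singularValues 0 with haa
  have ha0 : 0 < a :=
    (LinearMap.injective_iff_forall_lt_finrank_singularValues_pos (act P)).1 (act_injective hP) 0
      (by simp)
  rw [latticeDelta_eq hP, gaussSum, mul_assoc, ← ENNReal.tsum_mul_right, ← ENNReal.tsum_mul_left]
  refine le_trans (ENNReal.tsum_le_tsum fun n => ?_)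
    (ENNReal.tsum_comp_le_tsum_of_injective Subtype.val_injective
      (fun n : Fin 2 → ℤ => corrBound δ ς C₀ * (ENNReal.ofReal (Real.exp (-(δ / 8) * ‖latVec n‖ ^ 2))
        * ENNReal.ofReal (Real.exp (-(δ / 8) / a ^ 2)))))
  set γ := act P⁻¹.transpose (latVec n.1) with hγ
  have h1 : max (corr φ₀ φ γ) (corr φ₀ φ (-γ))
      ≤ corrBound δ ς C₀ * ENNReal.ofReal (Real.exp (-(δ / 4) * ‖γ‖ ^ 2)) := by
    refine max_le (corr_le hδ hς h γ) ?_
    have := corr_le hδ hς h (-γ)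
    rwa [norm_neg] at this
  refine h1.trans ?_
  rw [← ENNReal.ofReal_mul (Real.exp_nonneg _), ← Real.exp_add]
  gcongr
  have h2 := norm_latVec_le hP n.1
  rw [← hγ, ← haa] at h2
  have h3 : ‖latVec n.1‖ ^ 2 / a ^ 2 ≤ ‖γ‖ ^ 2 := by
    rw [div_le_iff₀ (by positivity), mul_comm, ← mul_pow]
    gcongr
  have h4 := one_le_norm_latVec_sq n.2
  have h5 : 1 / a ^ 2 ≤ ‖latVec n.1‖ ^ 2 / a ^ 2 := by gcongr
  have h6 : ‖latVec n.1‖ ^ 2 ≤ ‖latVec n.1‖ ^ 2 / a ^ 2 :=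
    le_div_self (sq_nonneg _) (by positivity) (pow_le_one₀ ha0.le ha)
  rw [show -(δ / 8) / a ^ 2 = -(δ / 8) * (1 / a ^ 2) by ring]
  nlinarith

/-- The constant in the exponential bound for `Δ(Λ)`. -/
def deltaBound (δ ς C₀ : ℝ) : ℝ :=
  (corrBound δ ς C₀ * gaussSum (δ / 8)).toReal + (corrBound δ ς C₀).toReal * Real.exp (δ / 8) + 1

theorem deltaBound_pos (δ ς C₀ : ℝ) : 0 < deltaBound δ ς C₀ := by
  rw [deltaBound]; positivity

theorem latticeDelta_le (hδ : 0 < δ) (hς : 2 < ς) (h : AdmissibleWindows δ ς C₀ A B φ₀ φ)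
    {P : Matrix (Fin 2) (Fin 2) ℝ} (hP : P.det ≠ 0)
    (hA : latticeDelta φ₀ φ P ≤ ENNReal.ofReal A) :
    latticeDelta φ₀ φ P ≤ ENNReal.ofReal (deltaBound δ ς C₀) * ENNReal.ofReal
      (Real.exp (-(δ / 8) / (act P).singularValues 0 ^ 2)
        + Real.exp (-(δ / 8) / (act P).singularValues 1 ^ 2)) := by
  have hC := corrBound_lt_top (δ := δ) (C₀ := C₀) hς
  have hG := ENNReal.mul_lt_top hC (gaussSum_lt_top (c := δ / 8) (by linarith))
  set a := (act P).singularValues 0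
  set E := Real.exp (-(δ / 8) / a ^ 2) with hE
  have hE1 : ENNReal.ofReal E ≤ ENNReal.ofReal
      (E + Real.exp (-(δ / 8) / (act P).singularValues 1 ^ 2)) :=
    ENNReal.ofReal_le_ofReal (le_add_of_nonneg_right (Real.exp_nonneg _))
  refine le_trans ?_ (mul_le_mul_right hE1 _)
  rcases le_total a 1 with ha | ha
  · refine (latticeDelta_le_of_le_one hδ hς h hP ha).trans ?_
    gcongr
    rw [← ENNReal.ofReal_toReal hG.ne]
    apply ENNReal.ofReal_le_ofReal
    rw [deltaBound]
    have : 0 ≤ (corrBound δ ς C₀).toReal * Real.exp (δ / 8) := by positivity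
    linarith
  -- For a coarse lattice `a ≥ 1` the target exponential is at least `exp(-δ/8)`, so the trivial
  -- bound by `A` is enough.
  · refine hA.trans ((ofReal_le_corrBound hδ hς h).trans ?_)
    rw [← ENNReal.ofReal_toReal hC.ne, ← ENNReal.ofReal_mul (deltaBound_pos δ ς C₀).le]
    apply ENNReal.ofReal_le_ofReal
    have h1 : Real.exp (-(δ / 8)) ≤ E := by
      rw [hE]
      apply Real.exp_le_exp.2
      rw [le_div_iff₀ (by positivity)]
      nlinarith [one_le_pow₀ (n := 2) ha]
    calc (corrBound δ ς C₀).toReal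
        = (corrBound δ ς C₀).toReal * Real.exp (δ / 8) * Real.exp (-(δ / 8)) := by
          rw [mul_assoc, ← Real.exp_add]; simp
      _ ≤ deltaBound δ ς C₀ * E := by
          have : 0 ≤ (corrBound δ ς C₀ * gaussSum (δ / 8)).toReal := ENNReal.toReal_nonneg
          have := deltaBound_pos δ ς C₀
          gcongr
          rw [deltaBound]
          linarith

end Decay

end Wavepacket

end

noncomputable section

namespace Wavepacket

section Schur

/-! ### The energy estimate for the off-diagonal terms -/

theorem ENNReal_tsum_option {ι : Type*} (f : Option ι → ℝ≥0∞) :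
    ∑' o, f o = f none + ∑' i, f (some i) := by
  rw [← (Equiv.optionEquivSumPUnit.{0} ι).symm.tsum_eq, ENNReal.summable.tsum_sum ENNReal.summable,
    add_comm]
  simp [Equiv.optionEquivSumPUnit]

theorem ENNReal_two_mul_le (a b : ℝ≥0∞) : 2 * (a * b) ≤ a ^ 2 + b ^ 2 := by
  wlog h : a ≤ b generalizing a b
  · rw [mul_comm a, add_comm]
    exact this b a (le_of_not_ge h)
  · obtain ⟨c, rfl⟩ := exists_add_of_le h
    calc 2 * (a * (a + c)) ≤ 2 * (a * (a + c)) + c ^ 2 := le_self_add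
      _ = _ := by ring

/-- The dilations of the coarse (`none`) and of the fine windows in frequency. -/
def scaleMat : Option ScaleRot → Matrix (Fin 2) (Fin 2) ℝ
  | none => 1
  | some i => matB i

theorem det_scaleMat_ne_zero (o : Option ScaleRot) : (scaleMat o).det ≠ 0 := by
  cases o with
  | none => simp [scaleMat]
  | some i => exact det_matB_ne_zero i

/-- The windows in frequency. -/
def window (φ₀ φ : L2) : Option ScaleRot → Plane → ℂ
  | none => (𝓕 φ₀ : L2)
  | some _ => (𝓕 φ : L2)

/-- The dilated windows in frequency. -/
def scaled (φ₀ φ : L2) (o : Option ScaleRot) (ξ : Plane) : ℂ :=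
  window φ₀ φ o (act (scaleMat o) ξ)

variable (φ₀ φ : L2)

theorem measurable_window (o : Option ScaleRot) : Measurable (window φ₀ φ o) := by
  cases o <;> exact (Lp.stronglyMeasurable _).measurable

theorem measurable_scaled (o : Option ScaleRot) : Measurable (scaled φ₀ φ o) :=
  (measurable_window φ₀ φ o).comp (measurable_act _)

theorem coverSum_eq (ξ : Plane) : coverSum φ₀ φ ξ = ∑' o, ‖scaled φ₀ φ o ξ‖ₑ ^ 2 := by
  rw [ENNReal_tsum_option]
  simp only [scaled, scaleMat, window, act_one]
  rfl

theorem ae_tsum_le_corr (ζ : Plane) :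
    ∀ᵐ ξ, ∑' o, ‖scaled φ₀ φ o ξ‖ₑ * ‖window φ₀ φ o (act (scaleMat o) ξ - ζ)‖ₑ
      ≤ corr φ₀ φ ζ := by
  rw [corr]
  simp_rw [ENNReal_tsum_option]
  simp only [scaled, scaleMat, window, act_one]
  exact ENNReal.ae_le_essSup _

variable (P : Matrix (Fin 2) (Fin 2) ℝ)

/-- The matrix whose inverse spans the lattice of frequency shifts at a given scale. -/
def shiftMat (o : Option ScaleRot) : Matrix (Fin 2) (Fin 2) ℝ := P.transpose * scaleMat o

variable {P}

theorem det_shiftMat (o : Option ScaleRot) :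
    (shiftMat P o).det = P.det * (scaleMat o).det := by
  rw [shiftMat, Matrix.det_mul, Matrix.det_transpose]

theorem det_shiftMat_ne_zero (hP : P.det ≠ 0) (o : Option ScaleRot) :
    (shiftMat P o).det ≠ 0 := by
  rw [det_shiftMat]
  exact mul_ne_zero hP (det_scaleMat_ne_zero o)

/-- The shifts differ from scale to scale, but in the coordinates of the window each becomes the
same dual lattice point. Hence a single `Θ(γ)` controls all scales at once. -/
theorem scaleMat_shift (o : Option ScaleRot) (v : Plane) :
    act (scaleMat o) (act (shiftMat P o)⁻¹ v) = act P⁻¹.transpose v := by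
  rw [shiftMat, Matrix.mul_inv_rev, ← act_act, act_act_inv (det_scaleMat_ne_zero o),
    Matrix.transpose_nonsing_inv]

theorem lintegral_tsum_mul_le {w : Option ScaleRot → Plane → ℝ≥0∞} (hw : ∀ o, Measurable (w o))
    {h : Plane → ℝ≥0∞} (hh : Measurable h) {C : ℝ≥0∞} (hC : ∀ᵐ ξ, ∑' o, w o ξ ≤ C) :
    ∑' o, ∫⁻ ξ, w o ξ * h ξ ≤ C * ∫⁻ ξ, h ξ := by
  rw [← lintegral_tsum (f := fun o ξ => w o ξ * h ξ) fun o => ((hw o).mul hh).aemeasurable, ← lintegral_const_mul _ hh]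
  refine lintegral_mono_ae ?_
  filter_upwards [hC] with ξ hξ
  rw [ENNReal.tsum_mul_right]
  gcongr

/-- A Schur-type estimate. After `2|F(ξ+s)||G(ξ)| ≤ |F(ξ+s)|² + |G(ξ)|²`, translating the first term
back by `s` leaves a window shifted by `γ`, while the second has one shifted by `-γ`; this is why
both `Θ(γ)` and `Θ(-γ)` enter `Δ`. -/
theorem two_mul_tsum_shiftEnergy_le {F G : Plane → ℂ} (hF : Measurable F) (hG : Measurable G)
    (n : Fin 2 → ℤ) :
    2 * ∑' o, shiftEnergy (shiftMat P o) (fun ξ => scaled φ₀ φ o ξ * F ξ)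
        (fun ξ => scaled φ₀ φ o ξ * G ξ) n
      ≤ max (corr φ₀ φ (act P⁻¹.transpose (latVec n)))
          (corr φ₀ φ (-act P⁻¹.transpose (latVec n)))
        * ((∫⁻ ξ, ‖F ξ‖ₑ ^ 2) + ∫⁻ ξ, ‖G ξ‖ₑ ^ 2) := by
  set γ := act P⁻¹.transpose (latVec n) with hγ
  let s : Option ScaleRot → Plane := fun o => act (shiftMat P o)⁻¹ (latVec n)
  have hs (o : Option ScaleRot) : act (scaleMat o) (s o) = γ := scaleMat_shift o _
  let w₁ : Option ScaleRot → Plane → ℝ≥0∞ := fun o ξ =>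
    ‖scaled φ₀ φ o ξ‖ₑ * ‖window φ₀ φ o (act (scaleMat o) ξ - γ)‖ₑ
  let w₂ : Option ScaleRot → Plane → ℝ≥0∞ := fun o ξ =>
    ‖scaled φ₀ φ o ξ‖ₑ * ‖window φ₀ φ o (act (scaleMat o) ξ - -γ)‖ₑ
  have hw (ζ : Plane) (o : Option ScaleRot) : Measurable fun ξ =>
      ‖scaled φ₀ φ o ξ‖ₑ * ‖window φ₀ φ o (act (scaleMat o) ξ - ζ)‖ₑ :=
    (measurable_scaled φ₀ φ o).enorm.mul
      ((measurable_window φ₀ φ o).comp ((measurable_act _).sub_const ζ)).enorm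
  have hF2 : Measurable fun ξ => ‖F ξ‖ₑ ^ 2 := hF.enorm.pow_const 2
  have hG2 : Measurable fun ξ => ‖G ξ‖ₑ ^ 2 := hG.enorm.pow_const 2
  have key (o : Option ScaleRot) :
      2 * shiftEnergy (shiftMat P o) (fun ξ => scaled φ₀ φ o ξ * F ξ)
        (fun ξ => scaled φ₀ φ o ξ * G ξ) n
      ≤ (∫⁻ ξ, w₁ o ξ * ‖F ξ‖ₑ ^ 2) + ∫⁻ ξ, w₂ o ξ * ‖G ξ‖ₑ ^ 2 := by
    have e1 : ∫⁻ ξ, w₁ o ξ * ‖F ξ‖ₑ ^ 2 = ∫⁻ ξ, w₁ o (ξ + s o) * ‖F (ξ + s o)‖ₑ ^ 2 :=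
      (lintegral_add_right_eq_self (fun ξ => w₁ o ξ * ‖F ξ‖ₑ ^ 2) (s o)).symm
    rw [e1, ← lintegral_add_right _ (g := fun ξ => w₂ o ξ * ‖G ξ‖ₑ ^ 2) ((hw _ o).mul hG2),
      shiftEnergy]
    rw [← lintegral_const_mul' _ _ ENNReal.ofNat_ne_top]
    refine lintegral_mono fun ξ => ?_
    have e2 : w₁ o (ξ + s o) = ‖scaled φ₀ φ o (ξ + s o)‖ₑ * ‖scaled φ₀ φ o ξ‖ₑ := by
      simp only [w₁, scaled, map_add, hs, add_sub_cancel_right]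
    have e3 : w₂ o ξ = ‖scaled φ₀ φ o (ξ + s o)‖ₑ * ‖scaled φ₀ φ o ξ‖ₑ := by
      simp only [w₂, scaled, map_add, hs, sub_neg_eq_add]
      rw [mul_comm]
    rw [e2, e3, ← mul_add, enorm_mul, enorm_mul]
    change 2 * (‖scaled φ₀ φ o (ξ + s o)‖ₑ * ‖F (ξ + s o)‖ₑ * (‖scaled φ₀ φ o ξ‖ₑ * ‖G ξ‖ₑ)) ≤ _
    calc 2 * (‖scaled φ₀ φ o (ξ + s o)‖ₑ * ‖F (ξ + s o)‖ₑ * (‖scaled φ₀ φ o ξ‖ₑ * ‖G ξ‖ₑ))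
        = ‖scaled φ₀ φ o (ξ + s o)‖ₑ * ‖scaled φ₀ φ o ξ‖ₑ * (2 * (‖F (ξ + s o)‖ₑ * ‖G ξ‖ₑ)) := by
          ring
      _ ≤ _ := by
          gcongr
          exact ENNReal_two_mul_le _ _
  rw [← ENNReal.tsum_mul_left]
  refine (ENNReal.tsum_le_tsum key).trans ?_
  rw [ENNReal.tsum_add, mul_add]
  refine add_le_add ?_ ?_
  · refine (lintegral_tsum_mul_le (fun o => hw γ o) hF2 (ae_tsum_le_corr φ₀ φ γ)).trans ?_
    gcongr
    exact le_max_left _ _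
  · refine (lintegral_tsum_mul_le (fun o => hw (-γ) o) hG2 (ae_tsum_le_corr φ₀ φ (-γ))).trans ?_
    gcongr
    exact le_max_right _ _

theorem two_mul_tsum_offDiag_le (hP : P.det ≠ 0) {F G : Plane → ℂ} (hF : Measurable F)
    (hG : Measurable G) :
    2 * ∑' o, ∑' n : {n : Fin 2 → ℤ // n ≠ 0}, shiftEnergy (shiftMat P o)
        (fun ξ => scaled φ₀ φ o ξ * F ξ) (fun ξ => scaled φ₀ φ o ξ * G ξ) n
      ≤ latticeDelta φ₀ φ P * ((∫⁻ ξ, ‖F ξ‖ₑ ^ 2) + ∫⁻ ξ, ‖G ξ‖ₑ ^ 2) := by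
  rw [ENNReal.tsum_comm, ← ENNReal.tsum_mul_left, latticeDelta_eq hP, ← ENNReal.tsum_mul_right]
  exact ENNReal.tsum_le_tsum fun n => two_mul_tsum_shiftEnergy_le φ₀ φ hF hG n

/-- The zero shift costs `Θ(0)` and the others cost `Δ`. The resulting bound yields both the Bessel
constant and the finiteness needed for Parseval. -/
theorem tsum_tsum_shiftEnergy_le (hP : P.det ≠ 0) {F : Plane → ℂ} (hF : Measurable F) :
    ∑' o, ∑' n : Fin 2 → ℤ, shiftEnergy (shiftMat P o)
        (fun ξ => scaled φ₀ φ o ξ * F ξ) (fun ξ => scaled φ₀ φ o ξ * F ξ) n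
      ≤ (corr φ₀ φ 0 + latticeDelta φ₀ φ P) * ∫⁻ ξ, ‖F ξ‖ₑ ^ 2 := by
  have h : 2 * ∑' o, ∑' n : Fin 2 → ℤ, shiftEnergy (shiftMat P o)
        (fun ξ => scaled φ₀ φ o ξ * F ξ) (fun ξ => scaled φ₀ φ o ξ * F ξ) n
      ≤ 2 * ((corr φ₀ φ 0 + latticeDelta φ₀ φ P) * ∫⁻ ξ, ‖F ξ‖ₑ ^ 2) := by
    simp_rw [fun o => ENNReal_tsum_eq_add_tsum_ne (fun n => shiftEnergy (shiftMat P o)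
      (fun ξ => scaled φ₀ φ o ξ * F ξ) (fun ξ => scaled φ₀ φ o ξ * F ξ) n) 0]
    rw [ENNReal.tsum_add, mul_add, add_mul, mul_add]
    refine add_le_add ?_ ?_
    · refine (two_mul_tsum_shiftEnergy_le φ₀ φ hF hF 0).trans (le_of_eq ?_)
      rw [show latVec (0 : Fin 2 → ℤ) = 0 by rw [latVec, intVec_zero]; rfl, map_zero, neg_zero,
        max_self]
      ring
    · exact (two_mul_tsum_offDiag_le φ₀ φ hP hF hF).trans (le_of_eq (by ring))
  exact (ENNReal.mul_le_mul_iff_right two_ne_zero ENNReal.ofNat_ne_top).1 h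

end Schur

end Wavepacket

end

noncomputable section

namespace Wavepacket

section Coefficients

/-! ### Coefficients with respect to the wavepackets -/

/-- All wavepackets at the points of `P ℤ²`, the coarse ones being indexed by `none`. -/
def packetAt (φ₀ φ : L2) (P : Matrix (Fin 2) (Fin 2) ℝ) : Option ScaleRot × (Fin 2 → ℤ) → L2
  | (none, n) => transl (act P (latVec n)) φ₀
  | (some i, n) => packet φ i (act P (latVec n))

variable (φ₀ φ ψ : L2) {P : Matrix (Fin 2) (Fin 2) ℝ}

theorem phase_eq_conj_character (o : Option ScaleRot) (n : Fin 2 → ℤ) (ξ : Plane) :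
    phase (act P (latVec n)) (act (scaleMat o) ξ)
      = conj (character n (latticeCoord (shiftMat P o) ξ)) := by
  have h : inner ℝ (act P (latVec n)) (act (scaleMat o) ξ)
      = ∑ l, (n l : ℝ) * latticeCoord (shiftMat P o) ξ l := by
    rw [inner_act_left, act_act, PiLp.inner_apply]
    refine Finset.sum_congr rfl fun l _ => ?_
    rw [RCLike.inner_apply, conj_trivial, mul_comm]
    rfl
  rw [phase, h, character, ← Complex.exp_conj]
  congr 1
  simp only [map_mul, Complex.conj_ofReal, Complex.conj_I, map_ofNat]
  ring

theorem fourier_packetAt (o : Option ScaleRot) (n : Fin 2 → ℤ) :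
    ∀ᵐ ξ, (𝓕 (packetAt φ₀ φ P (o, n)) : L2) ξ = ((Real.sqrt |(scaleMat o).det| : ℝ) : ℂ) *
      (conj (character n (latticeCoord (shiftMat P o) ξ)) * scaled φ₀ φ o ξ) := by
  simp_rw [← phase_eq_conj_character]
  cases o with
  | none =>
    filter_upwards [fourier_transl (act P (latVec n)) φ₀] with ξ hξ
    rw [packetAt, hξ]
    simp [scaleMat, scaled, window]
  | some i => exact fourier_packet φ i (act P (latVec n))

theorem inner_packetAt (o : Option ScaleRot) (n : Fin 2 → ℤ) (f : L2) :
    inner ℂ (packetAt φ₀ φ P (o, n)) f = ((Real.sqrt |(scaleMat o).det| : ℝ) : ℂ) *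
      planeCoeff (shiftMat P o) (fun ξ => conj (scaled φ₀ φ o ξ) * (𝓕 f : L2) ξ) n := by
  rw [← Lp.inner_fourier_eq, L2.inner_def, planeCoeff, ← integral_const_mul]
  refine integral_congr_ae ?_
  filter_upwards [fourier_packetAt φ₀ φ o n] with ξ hξ
  rw [hξ, RCLike.inner_apply, map_mul, map_mul, Complex.conj_conj, Complex.conj_ofReal]
  ring

theorem shiftEnergy_mono {N : Matrix (Fin 2) (Fin 2) ℝ} {H₁ H₂ K₁ K₂ : Plane → ℂ}
    (h₁ : ∀ᵐ ξ, ‖H₁ ξ‖ₑ ≤ ‖K₁ ξ‖ₑ) (h₂ : ∀ᵐ ξ, ‖H₂ ξ‖ₑ ≤ ‖K₂ ξ‖ₑ) (n : Fin 2 → ℤ) :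
    shiftEnergy N H₁ H₂ n ≤ shiftEnergy N K₁ K₂ n := by
  refine lintegral_mono_ae ?_
  filter_upwards [h₂, (measurePreserving_add_right (volume : Measure Plane)
    (act N⁻¹ (latVec n))).quasiMeasurePreserving.ae h₁] with ξ a b
  exact mul_le_mul' b a

theorem measurable_fourier (f : L2) : Measurable fun ξ => (𝓕 f : L2) ξ :=
  (Lp.stronglyMeasurable _).measurable

theorem lintegral_enorm_fourier_sq (f : L2) : ∫⁻ ξ, ‖(𝓕 f : L2) ξ‖ₑ ^ 2 = ‖f‖ₑ ^ 2 := by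
  rw [← enorm_sq_eq_lintegral, ← ofReal_norm, Lp.norm_fourier_eq, ofReal_norm]

variable {φ₀ φ ψ}

theorem enorm_conj_scaled_mul_le {o : Option ScaleRot}
    (hψ : ∀ᵐ ξ, ‖scaled φ₀ ψ o ξ‖ₑ ≤ ‖scaled φ₀ φ o ξ‖ₑ) (F : Plane → ℂ) :
    ∀ᵐ ξ, ‖conj (scaled φ₀ ψ o ξ) * F ξ‖ₑ ≤ ‖scaled φ₀ φ o ξ * F ξ‖ₑ := by
  filter_upwards [hψ] with ξ hξ
  rw [enorm_mul, enorm_mul, RCLike.enorm_conj]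
  gcongr

theorem measurable_conj_scaled_mul (φ₀ ψ : L2) (o : Option ScaleRot) (f : L2) :
    Measurable fun ξ => conj (scaled φ₀ ψ o ξ) * (𝓕 f : L2) ξ := by
  have h1 := measurable_scaled φ₀ ψ o
  have h2 := measurable_fourier f
  fun_prop

/-- The normalisation of the dilation cancels the part of the Jacobian that depends on the scale,
leaving `|det P|⁻¹` at every scale. The packets of `ψ` are controlled through `φ` by pointwise
domination. -/
theorem tsum_enorm_inner_packetAt_sq_le (hP : P.det ≠ 0)
    (hψ : ∀ o, ∀ᵐ ξ, ‖scaled φ₀ ψ o ξ‖ₑ ≤ ‖scaled φ₀ φ o ξ‖ₑ) (f : L2) :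
    ∑' p, ‖(inner ℂ (packetAt φ₀ ψ P p) f : ℂ)‖ₑ ^ 2
      ≤ ENNReal.ofReal |P.det⁻¹| * (corr φ₀ φ 0 + latticeDelta φ₀ φ P) * ‖f‖ₑ ^ 2 := by
  rw [ENNReal.tsum_prod', mul_assoc, ← lintegral_enorm_fourier_sq f]
  refine le_trans ?_ (mul_le_mul_right
    (tsum_tsum_shiftEnergy_le φ₀ φ hP (measurable_fourier f)) _)
  rw [← ENNReal.tsum_mul_left]
  refine ENNReal.tsum_le_tsum fun o => ?_
  simp_rw [inner_packetAt, enorm_mul, mul_pow]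
  rw [ENNReal.tsum_mul_left]
  have hd : ‖((Real.sqrt |(scaleMat o).det| : ℝ) : ℂ)‖ₑ ^ 2 = ENNReal.ofReal |(scaleMat o).det| := by
    rw [← ofReal_norm, ← ENNReal.ofReal_pow (norm_nonneg _), Complex.norm_real, Real.norm_eq_abs,
      sq_abs, Real.sq_sqrt (abs_nonneg _)]
  have hd2 : ENNReal.ofReal |(scaleMat o).det| * ENNReal.ofReal |(shiftMat P o).det⁻¹|
      = ENNReal.ofReal |P.det⁻¹| := by
    rw [← ENNReal.ofReal_mul (abs_nonneg _), ← abs_mul, det_shiftMat]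
    have := det_scaleMat_ne_zero o
    congr 2
    field_simp
  rw [hd]
  calc _ ≤ ENNReal.ofReal |(scaleMat o).det| * (ENNReal.ofReal |(shiftMat P o).det⁻¹| *
          ∑' n : Fin 2 → ℤ, shiftEnergy (shiftMat P o)
            (fun ξ => conj (scaled φ₀ ψ o ξ) * (𝓕 f : L2) ξ)
            (fun ξ => conj (scaled φ₀ ψ o ξ) * (𝓕 f : L2) ξ) n) := by
        gcongr
        exact tsum_enorm_planeCoeff_sq_le (det_shiftMat_ne_zero hP o)
          (measurable_conj_scaled_mul φ₀ ψ o f)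
    _ ≤ ENNReal.ofReal |P.det⁻¹| * ∑' n : Fin 2 → ℤ, shiftEnergy (shiftMat P o)
            (fun ξ => scaled φ₀ φ o ξ * (𝓕 f : L2) ξ)
            (fun ξ => scaled φ₀ φ o ξ * (𝓕 f : L2) ξ) n := by
        rw [← mul_assoc, hd2]
        gcongr with n
        exact shiftEnergy_mono (enorm_conj_scaled_mul_le (hψ o) _)
          (enorm_conj_scaled_mul_le (hψ o) _) n

theorem exists_hasSum_inner_packetAt (hP : P.det ≠ 0)
    (hψ : ∀ o, ∀ᵐ ξ, ‖scaled φ₀ ψ o ξ‖ₑ ≤ ‖scaled φ₀ φ o ξ‖ₑ)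
    (hfin : corr φ₀ φ 0 + latticeDelta φ₀ φ P < ⊤) (f g : L2) (o : Option ScaleRot) :
    ∃ W : ℂ, HasSum (fun n => (|P.det| : ℝ) * (inner ℂ (packetAt φ₀ ψ P (o, n)) f *
        inner ℂ g (packetAt φ₀ φ P (o, n)))) W ∧
      ‖W - ∫ ξ, conj (scaled φ₀ ψ o ξ) * (𝓕 f : L2) ξ *
          conj (conj (scaled φ₀ φ o ξ) * (𝓕 g : L2) ξ)‖ₑ
        ≤ ∑' n : {n : Fin 2 → ℤ // n ≠ 0}, shiftEnergy (shiftMat P o)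
          (fun ξ => scaled φ₀ φ o ξ * (𝓕 f : L2) ξ)
          (fun ξ => scaled φ₀ φ o ξ * (𝓕 g : L2) ξ) n := by
  have hN := det_shiftMat_ne_zero hP o
  have hφ : ∀ᵐ ξ, ‖scaled φ₀ φ o ξ‖ₑ ≤ ‖scaled φ₀ φ o ξ‖ₑ := .of_forall fun ξ => le_rfl
  have hE (χ : L2) (hχ : ∀ᵐ ξ, ‖scaled φ₀ χ o ξ‖ₑ ≤ ‖scaled φ₀ φ o ξ‖ₑ) (h : L2) :
      ∑' n, shiftEnergy (shiftMat P o) (fun ξ => conj (scaled φ₀ χ o ξ) * (𝓕 h : L2) ξ)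
        (fun ξ => conj (scaled φ₀ χ o ξ) * (𝓕 h : L2) ξ) n < ⊤ := by
    refine lt_of_le_of_lt (ENNReal.tsum_le_tsum fun n => shiftEnergy_mono
      (enorm_conj_scaled_mul_le hχ _) (enorm_conj_scaled_mul_le hχ _) n) ?_
    refine lt_of_le_of_lt ((ENNReal.le_tsum o).trans
      (tsum_tsum_shiftEnergy_le φ₀ φ hP (measurable_fourier h))) ?_
    rw [lintegral_enorm_fourier_sq]
    exact ENNReal.mul_lt_top hfin (ENNReal.pow_lt_top enorm_lt_top)
  obtain ⟨V, hV, hb⟩ := exists_hasSum_planeCoeff hN (measurable_conj_scaled_mul φ₀ ψ o f)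
    (measurable_conj_scaled_mul φ₀ φ o g) (hE ψ (hψ o) f) (hE φ hφ g)
  -- The second factor comes from the two square-root normalisations; the product is `|det (shiftMat
  -- P o)|`, which cancels the Jacobian of the Parseval identity.
  set q : ℝ := |P.det| * |(scaleMat o).det| with hq
  have hq1 : q * |(shiftMat P o).det⁻¹| = 1 := by
    rw [hq, ← abs_mul, ← abs_mul, ← det_shiftMat, mul_inv_cancel₀ hN, abs_one]
  have hq0 : 0 ≤ q := by positivity
  refine ⟨(q : ℂ) * V, (hV.mul_left (q : ℂ)).congr_fun fun n => ?_, ?_⟩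
  · rw [← inner_conj_symm g, inner_packetAt, inner_packetAt, map_mul, Complex.conj_ofReal, hq]
    have : (((Real.sqrt |(scaleMat o).det| : ℝ) : ℂ)) * ((Real.sqrt |(scaleMat o).det| : ℝ) : ℂ)
        = (|(scaleMat o).det| : ℝ) := by
      rw [← Complex.ofReal_mul, Real.mul_self_sqrt (abs_nonneg _)]
    rw [Complex.ofReal_mul, ← this]
    ring
  · set I : ℂ := ∫ ξ, conj (scaled φ₀ ψ o ξ) * (𝓕 f : L2) ξ *
      conj (conj (scaled φ₀ φ o ξ) * (𝓕 g : L2) ξ) with hI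
    have h1 : (q : ℂ) * V - I = (q : ℂ) * (V - (|(shiftMat P o).det⁻¹| : ℝ) * I) := by
      rw [mul_sub, ← mul_assoc, ← Complex.ofReal_mul, hq1, Complex.ofReal_one, one_mul]
    rw [h1, enorm_mul, show ‖(q : ℂ)‖ₑ = ENNReal.ofReal q by
      rw [← ofReal_norm, Complex.norm_real, Real.norm_of_nonneg hq0]]
    calc _ ≤ ENNReal.ofReal q * (ENNReal.ofReal |(shiftMat P o).det⁻¹| *
          ∑' n : {n : Fin 2 → ℤ // n ≠ 0}, shiftEnergy (shiftMat P o)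
            (fun ξ => conj (scaled φ₀ ψ o ξ) * (𝓕 f : L2) ξ)
            (fun ξ => conj (scaled φ₀ φ o ξ) * (𝓕 g : L2) ξ) n) := by
          gcongr
      _ = ∑' n : {n : Fin 2 → ℤ // n ≠ 0}, shiftEnergy (shiftMat P o)
            (fun ξ => conj (scaled φ₀ ψ o ξ) * (𝓕 f : L2) ξ)
            (fun ξ => conj (scaled φ₀ φ o ξ) * (𝓕 g : L2) ξ) n := by
          rw [← mul_assoc, ← ENNReal.ofReal_mul hq0, hq1, ENNReal.ofReal_one, one_mul]
      _ ≤ _ := ENNReal.tsum_le_tsum fun n => shiftEnergy_mono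
          (enorm_conj_scaled_mul_le (hψ o) _) (enorm_conj_scaled_mul_le hφ _) n

end Coefficients

section Bessel

/-! ### Bessel sequences -/

variable {E ι : Type*} [NormedAddCommGroup E] [InnerProductSpace ℂ E]

/-- Duality: expand `‖S‖² = ⟨S, S⟩`, apply Cauchy–Schwarz and the Bessel inequality to `S`, then
divide by `‖S‖`. -/
theorem enorm_sum_smul_sq_le {x : ι → E} {C : ℝ≥0∞}
    (hx : ∀ g, ∑' i, ‖(inner ℂ (x i) g : ℂ)‖ₑ ^ 2 ≤ C * ‖g‖ₑ ^ 2) (c : ι → ℂ) (s : Finset ι) :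
    ‖∑ i ∈ s, c i • x i‖ₑ ^ 2 ≤ C * ∑ i ∈ s, ‖c i‖ₑ ^ 2 := by
  set S := ∑ i ∈ s, c i • x i with hS
  have h1 : ‖S‖ₑ ^ 2 ≤ ∑ i ∈ s, ‖c i‖ₑ * ‖(inner ℂ (x i) S : ℂ)‖ₑ := by
    have h2 : (inner ℂ S S : ℂ) = ∑ i ∈ s, conj (c i) * inner ℂ (x i) S := by
      conv_lhs => rw [hS, sum_inner]
      refine Finset.sum_congr rfl fun i _ => ?_
      rw [inner_smul_left]
    have h3 : ‖S‖ₑ ^ 2 = ‖(inner ℂ S S : ℂ)‖ₑ := by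
      rw [inner_self_eq_norm_sq_to_K, enorm_pow]
      congr 1
      rw [← ofReal_norm, ← ofReal_norm]
      simp
    rw [h3, h2]
    refine (enorm_sum_le _ _).trans (le_of_eq (Finset.sum_congr rfl fun i _ => ?_))
    rw [enorm_mul, RCLike.enorm_conj]
  have h4 : ∑ i ∈ s, ‖c i‖ₑ * ‖(inner ℂ (x i) S : ℂ)‖ₑ
      ≤ (∑ i ∈ s, ‖c i‖ₑ ^ 2) ^ (1 / 2 : ℝ) * (C * ‖S‖ₑ ^ 2) ^ (1 / 2 : ℝ) := by
    have h5 := ENNReal.inner_le_Lp_mul_Lq s (fun i => ‖c i‖ₑ)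
      (fun i => ‖(inner ℂ (x i) S : ℂ)‖ₑ) Real.HolderConjugate.two_two
    simp only [ENNReal.rpow_two] at h5
    refine h5.trans ?_
    gcongr
    exact (ENNReal.sum_le_tsum s).trans (hx S)
  by_cases hS0 : ‖S‖ₑ = 0
  · simp [hS0]
  have hSt : ‖S‖ₑ ≠ ⊤ := enorm_ne_top
  have h6 := h1.trans h4
  rw [ENNReal.mul_rpow_of_nonneg _ _ (by norm_num : (0 : ℝ) ≤ 1 / 2), ← ENNReal.rpow_natCast ‖S‖ₑ 2,
    ← ENNReal.rpow_mul, show ((2 : ℕ) : ℝ) * (1 / 2) = 1 by norm_num, ENNReal.rpow_one,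
    ENNReal.rpow_natCast, sq, ← mul_assoc] at h6
  have h7 := (ENNReal.mul_le_mul_iff_left hS0 hSt).1 h6
  rw [← ENNReal.mul_rpow_of_nonneg _ _ (by norm_num : (0 : ℝ) ≤ 1 / 2)] at h7
  calc ‖S‖ₑ ^ 2 ≤ (((∑ i ∈ s, ‖c i‖ₑ ^ 2) * C) ^ (1 / 2 : ℝ)) ^ 2 := by gcongr
    _ = _ := by
      rw [← ENNReal.rpow_natCast, ← ENNReal.rpow_mul]
      norm_num
      rw [mul_comm]

theorem summable_smul_of_bessel [CompleteSpace E] {x : ι → E} {C : ℝ≥0∞} (hC : C ≠ ⊤)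
    (hx : ∀ g, ∑' i, ‖(inner ℂ (x i) g : ℂ)‖ₑ ^ 2 ≤ C * ‖g‖ₑ ^ 2) {c : ι → ℂ}
    (hc : ∑' i, ‖c i‖ₑ ^ 2 ≠ ⊤) : Summable fun i => c i • x i := by
  rw [summable_iff_vanishing_norm]
  intro ε hε
  have hs : Summable fun i => ‖c i‖ ^ 2 := by
    have := ENNReal.summable_toReal hc
    simpa using this
  have hε' : 0 < ε ^ 2 / (C.toReal + 1) := by positivity
  obtain ⟨s, hs'⟩ := summable_iff_vanishing_norm.1 hs _ hε'
  refine ⟨s, fun t ht => ?_⟩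
  have h1 := hs' t ht
  have h2 := ENNReal.toReal_mono (ENNReal.mul_ne_top hC
    (ENNReal.sum_ne_top.2 fun i _ => ENNReal.pow_ne_top enorm_ne_top))
    (enorm_sum_smul_sq_le hx c t)
  rw [ENNReal.toReal_mul, ENNReal.toReal_pow, toReal_enorm,
    ENNReal.toReal_sum fun i _ => ENNReal.pow_ne_top enorm_ne_top] at h2
  simp only [ENNReal.toReal_pow, toReal_enorm] at h2
  rw [Real.norm_of_nonneg (by positivity), lt_div_iff₀ (by positivity)] at h1
  have h0 : 0 ≤ ∑ i ∈ t, ‖c i‖ ^ 2 := by positivity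
  refine lt_of_pow_lt_pow_left₀ 2 hε.le ?_
  nlinarith

/-- Testing with `g = t R` and `t = a/‖R‖` makes the two squares equal and turns the additive bound
into a product. -/
theorem norm_le_of_inner_le {R : E} {a d : ℝ} (ha : 0 ≤ a) (hd : 0 ≤ d)
    (h : ∀ g : E, 2 * ‖(inner ℂ g R : ℂ)‖ ≤ d * (a ^ 2 + ‖g‖ ^ 2)) : ‖R‖ ≤ d * a := by
  by_cases hR : R = 0
  · rw [hR, norm_zero]; positivity
  have hR0 : 0 < ‖R‖ := norm_pos_iff.2 hR
  have key (t : ℝ) (ht : 0 ≤ t) : 2 * (t * ‖R‖ ^ 2) ≤ d * (a ^ 2 + (t * ‖R‖) ^ 2) := by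
    have h1 := h ((t : ℂ) • R)
    rw [inner_smul_left, norm_mul, norm_smul, Complex.conj_ofReal, Complex.norm_real,
      Real.norm_of_nonneg ht, inner_self_eq_norm_sq_to_K] at h1
    simpa using h1
  rcases ha.eq_or_lt with ha0 | ha0
  · exfalso
    -- When `a = 0` the optimal `t` degenerates; any positive `t` with `d t < 2` contradicts `R ≠
    -- 0`.
    have h2 := key (1 / (d + 1)) (by positivity)
    rw [← ha0] at h2
    have h3 : d * (0 ^ 2 + (1 / (d + 1) * ‖R‖) ^ 2)
        = (d / (d + 1)) * (1 / (d + 1) * ‖R‖ ^ 2) := by field_simp; ring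
    have h4 : d / (d + 1) ≤ 1 := by rw [div_le_one (by positivity)]; linarith
    have h5 : 0 < 1 / (d + 1) * ‖R‖ ^ 2 := by positivity
    rw [h3] at h2
    nlinarith
  · have h2 := key (a / ‖R‖) (by positivity)
    have h3 : a / ‖R‖ * ‖R‖ ^ 2 = a * ‖R‖ := by field_simp
    have h4 : a / ‖R‖ * ‖R‖ = a := by field_simp
    rw [h3, h4] at h2
    have h5 : a * ‖R‖ ≤ a * (d * a) := by nlinarith
    exact le_of_mul_le_mul_left h5 ha0

end Bessel

end Wavepacket

end

noncomputable section

namespace Wavepacket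

section Symbol

/-! ### The symbol of the modified window -/

/-- The cut-off in the coordinates of each scale; there is none at the coarse scale. -/
def cutAt (η : Plane → ℝ) : Option ScaleRot → Plane → ℝ
  | none, _ => 1
  | some i, ξ => η (act (matB i) ξ)

/-- The symbol `m̃` as a series of nonnegative terms. -/
def symbolSum (φ₀ φ : L2) (η : Plane → ℝ) (ξ : Plane) : ℝ≥0∞ :=
  ∑' o, ENNReal.ofReal (cutAt η o ξ) * ‖scaled φ₀ φ o ξ‖ₑ ^ 2

variable {δ ς C₀ A B ε : ℝ} {φ₀ φ ψ : L2} {η : Plane → ℝ}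

theorem cutAt_mem (hη : IsCutoff ε φ η) (o : Option ScaleRot) (ξ : Plane) :
    cutAt η o ξ ∈ Set.Icc (0 : ℝ) 1 := by
  cases o with
  | none => exact ⟨zero_le_one, le_rfl⟩
  | some i => exact hη.range _

theorem measurable_symbolSum (hη : IsCutoff ε φ η) : Measurable (symbolSum φ₀ φ η) := by
  refine Measurable.tsum fun o => ?_
  refine Measurable.mul (Measurable.ennreal_ofReal ?_) ((measurable_scaled φ₀ φ o).enorm.pow_const 2)
  cases o with
  | none => exact measurable_const
  | some i => exact hη.smooth.continuous.measurable.comp (measurable_act _)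

theorem scaled_filtered (hψ : IsFiltered (fun ξ => (η ξ : ℂ)) φ ψ) (o : Option ScaleRot) :
    ∀ᵐ ξ, scaled φ₀ ψ o ξ = (cutAt η o ξ : ℂ) * scaled φ₀ φ o ξ := by
  cases o with
  | none => exact .of_forall fun ξ => by simp [scaled, window, cutAt]
  | some i => exact (quasiMeasurePreserving_matB i).ae hψ

theorem enorm_scaled_filtered_le (hη : IsCutoff ε φ η)
    (hψ : IsFiltered (fun ξ => (η ξ : ℂ)) φ ψ) (o : Option ScaleRot) :
    ∀ᵐ ξ, ‖scaled φ₀ ψ o ξ‖ₑ ≤ ‖scaled φ₀ φ o ξ‖ₑ := by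
  filter_upwards [scaled_filtered (φ₀ := φ₀) hψ o] with ξ hξ
  rw [hξ, enorm_mul]
  refine mul_le_of_le_one_left (zero_le) ?_
  have := cutAt_mem hη o ξ
  rw [← ofReal_norm, Complex.norm_real, Real.norm_of_nonneg this.1]
  exact ENNReal.ofReal_le_one.2 this.2

theorem symbolSum_le (h : AdmissibleWindows δ ς C₀ A B φ₀ φ) (hη : IsCutoff ε φ η) :
    ∀ᵐ ξ, symbolSum φ₀ φ η ξ ≤ ENNReal.ofReal B := by
  filter_upwards [h.cover] with ξ hξ
  refine le_trans ?_ hξ.2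
  rw [coverSum_eq]
  refine ENNReal.tsum_le_tsum fun o => mul_le_of_le_one_left (zero_le) ?_
  exact ENNReal.ofReal_le_one.2 (cutAt_mem hη o ξ).2

/-- Termwise `|φ̂|² ≤ η|φ̂|² + ε|φ̂|`: either `η = 1`, or `|φ̂| ≤ ε`. The last terms sum to at most
`ε ‖φ̂‖_*`. -/
theorem lowerBound_le_symbolSum (h : AdmissibleWindows δ ς C₀ A B φ₀ φ) (hη : IsCutoff ε φ η) :
    ∀ᵐ ξ, lowerBound A ε φ ≤ symbolSum φ₀ φ η ξ := by
  have h1 : ∀ᵐ ξ, ∑' i : ScaleRot, ‖(𝓕 φ : L2) (act (matB i) ξ)‖ₑ ≤ starNorm (𝓕 φ : L2) :=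
    ENNReal.ae_le_essSup _
  have h2 : ∀ᵐ ξ, ∀ i : ScaleRot, ε < ‖(𝓕 φ : L2) (act (matB i) ξ)‖ → η (act (matB i) ξ) = 1 :=
    ae_all_iff.2 fun i => (quasiMeasurePreserving_matB i).ae hη.eq_one
  filter_upwards [h.cover, h1, h2] with ξ c1 c2 c3
  rw [lowerBound, tsub_le_iff_right]
  refine c1.1.trans ?_
  rw [coverSum, symbolSum, ENNReal_tsum_option, add_assoc]
  have e0 : scaled φ₀ φ none ξ = (𝓕 φ₀ : L2) ξ := by simp [scaled, window, scaleMat]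
  rw [cutAt, ENNReal.ofReal_one, one_mul, e0]
  gcongr
  refine le_trans ?_ (add_le_add_right (mul_le_mul_right c2 (ENNReal.ofReal ε)) _)
  rw [← ENNReal.tsum_mul_left, ← ENNReal.tsum_add]
  refine ENNReal.tsum_le_tsum fun i => ?_
  change ‖(𝓕 φ : L2) (act (matB i) ξ)‖ₑ ^ 2 ≤ ENNReal.ofReal (η (act (matB i) ξ))
    * ‖(𝓕 φ : L2) (act (matB i) ξ)‖ₑ ^ 2 + _
  by_cases hi : ε < ‖(𝓕 φ : L2) (act (matB i) ξ)‖
  · rw [c3 i hi, ENNReal.ofReal_one, one_mul]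
    exact le_self_add
  · refine le_trans ?_ le_add_self
    rw [sq]
    gcongr
    rw [← ofReal_norm]
    exact ENNReal.ofReal_le_ofReal (not_lt.1 hi)

theorem toReal_symbol_term (hη : IsCutoff ε φ η) (o : Option ScaleRot) (ξ : Plane) :
    (ENNReal.ofReal (cutAt η o ξ) * ‖scaled φ₀ φ o ξ‖ₑ ^ 2).toReal
      = cutAt η o ξ * ‖scaled φ₀ φ o ξ‖ ^ 2 := by
  rw [ENNReal.toReal_mul, ENNReal.toReal_ofReal (cutAt_mem hη o ξ).1, ENNReal.toReal_pow,
    toReal_enorm]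

theorem symbol_term_ne_top (o : Option ScaleRot) (ξ : Plane) :
    ENNReal.ofReal (cutAt η o ξ) * ‖scaled φ₀ φ o ξ‖ₑ ^ 2 ≠ ⊤ :=
  ENNReal.mul_ne_top ENNReal.ofReal_ne_top (ENNReal.pow_ne_top enorm_ne_top)

theorem modSymbol_eq (h : AdmissibleWindows δ ς C₀ A B φ₀ φ) (hη : IsCutoff ε φ η)
    (hψ : IsFiltered (fun ξ => (η ξ : ℂ)) φ ψ) :
    ∀ᵐ ξ : Plane,
      Summable (fun i : ScaleRot =>
        (𝓕 φ : L2) (act (matB i) ξ) * conj ((𝓕 ψ : L2) (act (matB i) ξ))) ∧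
      modSymbol φ₀ φ ψ ξ = ((symbolSum φ₀ φ η ξ).toReal : ℂ) := by
  have h1 : ∀ᵐ ξ, ∀ i : ScaleRot, scaled φ₀ ψ (some i) ξ
      = (cutAt η (some i) ξ : ℂ) * scaled φ₀ φ (some i) ξ :=
    ae_all_iff.2 fun i => scaled_filtered hψ (some i)
  filter_upwards [symbolSum_le h hη, h1] with ξ hB hs
  let x : Option ScaleRot → ℝ≥0∞ := fun o =>
    ENNReal.ofReal (cutAt η o ξ) * ‖scaled φ₀ φ o ξ‖ₑ ^ 2
  have hx : symbolSum φ₀ φ η ξ = x none + ∑' i, x (some i) := ENNReal_tsum_option x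
  have hfin : x none + ∑' i, x (some i) ≠ ⊤ := by
    rw [← hx]; exact ne_top_of_le_ne_top ENNReal.ofReal_ne_top hB
  have hfin2 : ∑' i, x (some i) ≠ ⊤ := (ENNReal.add_ne_top.1 hfin).2
  have ht (i : ScaleRot) : (𝓕 φ : L2) (act (matB i) ξ) * conj ((𝓕 ψ : L2) (act (matB i) ξ))
      = (((x (some i)).toReal : ℝ) : ℂ) := by
    have e1 : (𝓕 ψ : L2) (act (matB i) ξ) = (cutAt η (some i) ξ : ℂ) * (𝓕 φ : L2) (act (matB i) ξ) :=
      hs i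
    simp only [x]
    rw [toReal_symbol_term hη, e1, map_mul, Complex.conj_ofReal, mul_left_comm, Complex.mul_conj,
      Complex.normSq_eq_norm_sq]
    push_cast
    rfl
  have hsum := ENNReal.summable_toReal hfin2
  constructor
  · simp_rw [ht]
    exact Complex.ofRealCLM.summable hsum
  · rw [modSymbol]
    simp_rw [ht]
    rw [hx, ENNReal.toReal_add (ENNReal.add_ne_top.1 hfin).1 hfin2,
      ENNReal.tsum_toReal_eq fun i => symbol_term_ne_top (some i) ξ, Complex.ofReal_add,
      Complex.ofReal_tsum]
    congr 2
    simp only [x]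
    rw [toReal_symbol_term hη, cutAt, one_mul]
    simp [scaled, window, scaleMat]

theorem hasSum_integral_of_tsum_lintegral {α ι : Type*} [Countable ι] [MeasurableSpace α]
    {μ : Measure α} {F : ι → α → ℂ} (hF : ∀ i, AEStronglyMeasurable (F i) μ)
    (h : ∑' i, ∫⁻ a, ‖F i a‖ₑ ∂μ ≠ ⊤) :
    HasSum (fun i => ∫ a, F i a ∂μ) (∫ a, ∑' i, F i a ∂μ) := by
  refine hasSum_integral_of_summable_integral_norm
    (fun i => ⟨hF i, (ENNReal.le_tsum i).trans_lt h.lt_top⟩) ?_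
  simp_rw [fun i => integral_norm_eq_lintegral_enorm (hF i)]
  exact ENNReal.summable_toReal h

/-- Interchanging sum and integral, the windows add up to `m̃`, which cancels the division in `f'`
and leaves `⟨f, g⟩` by Plancherel. The interchange is justified by the zero-shift energy, bounded by
`Θ(0)`. -/
theorem hasSum_diagonal {P : Matrix (Fin 2) (Fin 2) ℝ}
    (h : AdmissibleWindows δ ς C₀ A B φ₀ φ) (hη : IsCutoff ε φ η)
    (hψ : IsFiltered (fun ξ => (η ξ : ℂ)) φ ψ)
    (hfin : corr φ₀ φ 0 + latticeDelta φ₀ φ P < ⊤) (hL : ∀ᵐ ξ, symbolSum φ₀ φ η ξ ≠ 0)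
    {f f' : L2} (hf : IsFiltered (fun ξ => 1 / modSymbol φ₀ φ ψ ξ) f f') (g : L2) :
    HasSum (fun o => ∫ ξ, conj (scaled φ₀ ψ o ξ) * (𝓕 f' : L2) ξ *
      conj (conj (scaled φ₀ φ o ξ) * (𝓕 g : L2) ξ)) (inner ℂ g f) := by
  have hF := measurable_fourier f'
  have hG := measurable_fourier g
  have hs : ∀ᵐ ξ, ∀ o, scaled φ₀ ψ o ξ = (cutAt η o ξ : ℂ) * scaled φ₀ φ o ξ :=
    ae_all_iff.2 fun o => scaled_filtered hψ o
  have key := hasSum_integral_of_tsum_lintegral (μ := (volume : Measure Plane))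
    (F := fun o ξ => conj (scaled φ₀ ψ o ξ) * (𝓕 f' : L2) ξ *
      conj (conj (scaled φ₀ φ o ξ) * (𝓕 g : L2) ξ)) (fun o => ?_) ?_
  · convert key using 1
    rw [← Lp.inner_fourier_eq, L2.inner_def]
    refine integral_congr_ae ?_
    filter_upwards [hs, symbolSum_le h hη, hL, modSymbol_eq h hη hψ, hf] with ξ h1 h2 h3 h4 h5
    have hne : symbolSum φ₀ φ η ξ ≠ ⊤ := ne_top_of_le_ne_top ENNReal.ofReal_ne_top h2
    have e1 (o : Option ScaleRot) : conj (scaled φ₀ ψ o ξ) * (𝓕 f' : L2) ξ *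
        conj (conj (scaled φ₀ φ o ξ) * (𝓕 g : L2) ξ)
        = (((ENNReal.ofReal (cutAt η o ξ) * ‖scaled φ₀ φ o ξ‖ₑ ^ 2).toReal : ℝ) : ℂ)
          * ((𝓕 f' : L2) ξ * conj ((𝓕 g : L2) ξ)) := by
      rw [toReal_symbol_term hη, h1, Complex.ofReal_mul, ← Complex.normSq_eq_norm_sq,
        ← Complex.mul_conj, map_mul, map_mul, Complex.conj_ofReal, Complex.conj_conj]
      ring
    simp_rw [e1]
    rw [tsum_mul_right, ← Complex.ofReal_tsum,
      ← ENNReal.tsum_toReal_eq fun o => symbol_term_ne_top o ξ]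
    change _ = (((symbolSum φ₀ φ η ξ).toReal : ℝ) : ℂ) * _
    rw [h5, h4.2, RCLike.inner_apply]
    have : (((symbolSum φ₀ φ η ξ).toReal : ℝ) : ℂ) ≠ 0 := by
      exact_mod_cast (ENNReal.toReal_pos h3 hne).ne'
    field_simp
  · have h1 := measurable_scaled φ₀ ψ o
    have h2 := measurable_scaled φ₀ φ o
    exact Measurable.aestronglyMeasurable (by fun_prop)
  · have h1 := two_mul_tsum_shiftEnergy_le (P := P) φ₀ φ hF hG 0
    have h0 : latVec (0 : Fin 2 → ℤ) = 0 := by rw [latVec, intVec_zero]; rfl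
    rw [h0, map_zero, neg_zero, max_self, lintegral_enorm_fourier_sq,
      lintegral_enorm_fourier_sq] at h1
    have h2 : corr φ₀ φ 0 * (‖f'‖ₑ ^ 2 + ‖g‖ₑ ^ 2) ≠ ⊤ :=
      ENNReal.mul_ne_top (ENNReal.add_lt_top.1 hfin).1.ne (ENNReal.add_ne_top.2
        ⟨ENNReal.pow_ne_top enorm_ne_top, ENNReal.pow_ne_top enorm_ne_top⟩)
    refine ne_top_of_le_ne_top h2 (le_trans (ENNReal.tsum_le_tsum fun o => ?_)
      ((le_mul_of_one_le_left (zero_le) one_le_two).trans h1))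
    rw [shiftEnergy, h0, map_zero]
    refine lintegral_mono_ae ?_
    filter_upwards [enorm_conj_scaled_mul_le (enorm_scaled_filtered_le hη hψ o)
      (fun ξ => (𝓕 f' : L2) ξ)] with ξ hξ
    rw [add_zero, enorm_mul, RCLike.enorm_conj]
    refine mul_le_mul' hξ (le_of_eq ?_)
    rw [enorm_mul, enorm_mul, RCLike.enorm_conj]

theorem inner_filtered {σ : Plane → ℂ} (hσ : ∀ᵐ ξ, conj (σ ξ) = σ ξ) {y d f f' : L2}
    (hd : IsFiltered σ y d) (hf : IsFiltered σ f f') :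
    (inner ℂ d f : ℂ) = inner ℂ y f' := by
  rw [← Lp.inner_fourier_eq, ← Lp.inner_fourier_eq y, L2.inner_def, L2.inner_def]
  refine integral_congr_ae ?_
  filter_upwards [hσ, hd, hf] with ξ h1 h2 h3
  rw [h2, h3, RCLike.inner_apply, RCLike.inner_apply, map_mul, h1]
  ring

end Symbol

/-! ### Convergence of the expansion and the error estimate -/

section Synthesis

variable {δ ς C₀ A B ε : ℝ} {φ₀ φ ψ : L2} {η : Plane → ℝ} {P : Matrix (Fin 2) (Fin 2) ℝ}

theorem summable_packets (hP : P.det ≠ 0) (hη : IsCutoff ε φ η)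
    (hψ : IsFiltered (fun ξ => (η ξ : ℂ)) φ ψ)
    (hfin : corr φ₀ φ 0 + latticeDelta φ₀ φ P < ⊤) (f : L2) :
    Summable fun p => (inner ℂ (packetAt φ₀ ψ P p) f : ℂ) • packetAt φ₀ φ P p := by
  have hC : ENNReal.ofReal |P.det⁻¹| * (corr φ₀ φ 0 + latticeDelta φ₀ φ P) ≠ ⊤ :=
    ENNReal.mul_ne_top ENNReal.ofReal_ne_top hfin.ne
  have hx (g : L2) : ∑' p, ‖(inner ℂ (packetAt φ₀ φ P p) g : ℂ)‖ₑ ^ 2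
      ≤ ENNReal.ofReal |P.det⁻¹| * (corr φ₀ φ 0 + latticeDelta φ₀ φ P) * ‖g‖ₑ ^ 2 :=
    tsum_enorm_inner_packetAt_sq_le (φ₀ := φ₀) (φ := φ) (ψ := φ) hP
      (fun o => .of_forall fun ξ => le_rfl) g
  have hf := tsum_enorm_inner_packetAt_sq_le (φ₀ := φ₀) (φ := φ) (ψ := ψ) hP
    (enorm_scaled_filtered_le hη hψ) f
  have hc := ne_top_of_le_ne_top (ENNReal.mul_ne_top hC (ENNReal.pow_ne_top enorm_ne_top)) hf
  exact summable_smul_of_bessel (x := packetAt φ₀ φ P)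
    (c := fun p => (inner ℂ (packetAt φ₀ ψ P p) f : ℂ)) hC hx hc

/-- In the pairing with `g` the diagonal parts at all scales reproduce `⟨f, g⟩`, so only the nonzero
shifts contribute to the error. -/
theorem norm_sub_synthesis_le (h : AdmissibleWindows δ ς C₀ A B φ₀ φ) (hP : P.det ≠ 0)
    (hη : IsCutoff ε φ η) (hψ : IsFiltered (fun ξ => (η ξ : ℂ)) φ ψ)
    (hfin : corr φ₀ φ 0 + latticeDelta φ₀ φ P < ⊤) (hL : ∀ᵐ ξ, symbolSum φ₀ φ η ξ ≠ 0)
    {f f' : L2} (hf : IsFiltered (fun ξ => 1 / modSymbol φ₀ φ ψ ξ) f f') {S : L2}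
    (hS : HasSum (fun p => (inner ℂ (packetAt φ₀ ψ P p) f' : ℂ) • packetAt φ₀ φ P p) S) :
    ‖f - ((|P.det| : ℝ) : ℂ) • S‖ ≤ (latticeDelta φ₀ φ P).toReal * ‖f'‖ := by
  have hΔ := (ENNReal.add_lt_top.1 hfin).2
  refine norm_le_of_inner_le (norm_nonneg _) ENNReal.toReal_nonneg fun g => ?_
  choose W hW hWb using exists_hasSum_inner_packetAt hP (enorm_scaled_filtered_le hη hψ) hfin f' g
  have hT : HasSum W (inner ℂ g (((|P.det| : ℝ) : ℂ) • S)) := by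
    have h1 := ((innerSL ℂ g).hasSum hS).mul_left ((|P.det| : ℝ) : ℂ)
    rw [inner_smul_right]
    refine HasSum.prod_fiberwise (f := fun p : Option ScaleRot × (Fin 2 → ℤ) =>
      ((|P.det| : ℝ) : ℂ) * ((inner ℂ (packetAt φ₀ ψ P p) f' : ℂ) *
        inner ℂ g (packetAt φ₀ φ P p))) ?_ hW
    refine h1.congr_fun fun p => ?_
    rw [innerSL_apply_apply, inner_smul_right]
  have hD := hasSum_diagonal h hη hψ hfin hL hf g
  have h2 : 2 * ‖(inner ℂ g (f - ((|P.det| : ℝ) : ℂ) • S) : ℂ)‖ₑ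
      ≤ latticeDelta φ₀ φ P * (‖f'‖ₑ ^ 2 + ‖g‖ₑ ^ 2) := by
    rw [inner_sub_right, ← neg_sub, enorm_neg, ← (hT.sub hD).tsum_eq,
      ← lintegral_enorm_fourier_sq, ← lintegral_enorm_fourier_sq]
    refine le_trans (mul_le_mul_right ?_ _) (two_mul_tsum_offDiag_le φ₀ φ hP
      (measurable_fourier f') (measurable_fourier g))
    exact enorm_tsum_le_tsum_enorm.trans (ENNReal.tsum_le_tsum hWb)
  have h3 := ENNReal.toReal_mono (ENNReal.mul_ne_top hΔ.ne (ENNReal.add_ne_top.2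
    ⟨ENNReal.pow_ne_top enorm_ne_top, ENNReal.pow_ne_top enorm_ne_top⟩)) h2
  rw [ENNReal.toReal_mul, ENNReal.toReal_mul, ENNReal.toReal_add (ENNReal.pow_ne_top enorm_ne_top)
    (ENNReal.pow_ne_top enorm_ne_top), ENNReal.toReal_pow, ENNReal.toReal_pow, toReal_enorm,
    toReal_enorm, toReal_enorm] at h3
  simpa only [ENNReal.toReal_ofNat] using h3

/-- Coarse and fine packets together are indexed by `Option ScaleRot × ℤ²`. -/
def packetIndexEquiv :
    (Fin 2 → ℤ) ⊕ (ScaleRot × (Fin 2 → ℤ)) ≃ Option ScaleRot × (Fin 2 → ℤ) where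
  toFun := Sum.elim (fun n => (none, n)) fun p => (some p.1, p.2)
  invFun p := match p with
    | (none, n) => Sum.inl n
    | (some i, n) => Sum.inr (i, n)
  left_inv p := by rcases p with n | ⟨i, n⟩ <;> rfl
  right_inv p := by rcases p with ⟨_ | i, n⟩ <;> rfl

end Synthesis

end Wavepacket

end

/-! ### The main theorem -/

open Wavepacket in
theorem mainTheorem4 (δ ς C₀ : ℝ) (hδ : 0 < δ) (hς : 2 < ς) :
    ∃ τ K : ℝ, 0 < τ ∧ τ < δ ∧ 0 < K ∧
      ∀ (A B : ℝ) (φ₀ φ : L2), AdmissibleWindows δ ς C₀ A B φ₀ φ →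
      ∀ (ε : ℝ), 0 < ε →
      ∀ (η : Plane → ℝ), IsCutoff ε φ η →
      ∀ (ψ : L2), IsFiltered (fun ξ => (η ξ : ℂ)) φ ψ →
      ∀ (P : Matrix (Fin 2) (Fin 2) ℝ), P.det ≠ 0 →
      ENNReal.ofReal ε * starNorm (𝓕 φ : L2) < ENNReal.ofReal A →
      latticeDelta φ₀ φ P < lowerBound A ε φ →
      -- the symbol of the filter is well defined and bounded below and above
      (∀ᵐ ξ : Plane,
        Summable (fun i : ScaleRot =>
          (𝓕 φ : L2) (act (matB i) ξ) * conj ((𝓕 ψ : L2) (act (matB i) ξ))) ∧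
        ∃ r : ℝ, modSymbol φ₀ φ ψ ξ = (r : ℂ) ∧ lowerBound A ε φ ≤ ENNReal.ofReal r ∧
          ENNReal.ofReal r ≤ ENNReal.ofReal B + ENNReal.ofReal ε * starNorm (𝓕 φ : L2)) ∧
      -- the filtered packets exist and give the approximate expansion
      ∃ (dualCoarse : lattice P → L2) (dualFine : ScaleRot × lattice P → L2),
        (∀ l : lattice P,
          IsFiltered (fun ξ => 1 / modSymbol φ₀ φ ψ ξ) (transl l φ₀) (dualCoarse l)) ∧
        (∀ p : ScaleRot × lattice P,
          IsFiltered (fun ξ => 1 / modSymbol φ₀ φ ψ ξ) (packet ψ p.1 p.2) (dualFine p)) ∧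
        ∀ f : L2, ∃ g₀ g₁ : L2,
          HasSum (fun l : lattice P => inner ℂ (dualCoarse l) f • transl l φ₀) g₀ ∧
          HasSum (fun p : ScaleRot × lattice P =>
            inner ℂ (dualFine p) f • packet φ p.1 p.2) g₁ ∧
          ‖f - ((|P.det| : ℝ) : ℂ) • (g₀ + g₁)‖ₑ ≤ latticeDelta φ₀ φ P / lowerBound A ε φ * ‖f‖ₑ ∧
          latticeDelta φ₀ φ P / lowerBound A ε φ * ‖f‖ₑ ≤
            ENNReal.ofReal K / lowerBound A ε φ *
              ENNReal.ofReal
                (Real.exp (-τ / (act P).singularValues 0 ^ 2)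
                  + Real.exp (-τ / (act P).singularValues 1 ^ 2)) * ‖f‖ₑ := by
  refine ⟨δ / 8, deltaBound δ ς C₀, by linarith, by linarith, deltaBound_pos δ ς C₀, ?_⟩
  intro A B φ₀ φ h ε hε η hη ψ hψ P hP hstar hΔ
  set L := lowerBound A ε φ with hLdef
  have hLA : L ≤ ENNReal.ofReal A := tsub_le_self
  have hL0 : L ≠ 0 := (tsub_pos_of_lt hstar).ne'
  have hLt : L ≠ ⊤ := ne_top_of_le_ne_top ENNReal.ofReal_ne_top hLA
  have hLr : 0 < L.toReal := ENNReal.toReal_pos hL0 hLt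
  have hlow := lowerBound_le_symbolSum h hη
  have hup := symbolSum_le h hη
  have hmod := modSymbol_eq h hη hψ
  have hne : ∀ᵐ ξ, symbolSum φ₀ φ η ξ ≠ 0 := by
    filter_upwards [hlow] with ξ hξ
    exact ((pos_iff_ne_zero.2 hL0).trans_le hξ).ne'
  have hfin : corr φ₀ φ 0 + latticeDelta φ₀ φ P < ⊤ := by
    refine ENNReal.add_lt_top.2 ⟨?_, hΔ.trans (lt_top_iff_ne_top.2 hLt)⟩
    exact (corr_le hδ hς h 0).trans_lt
      (ENNReal.mul_lt_top (corrBound_lt_top hς) ENNReal.ofReal_lt_top)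
  have hσm : AEStronglyMeasurable (fun ξ => 1 / modSymbol φ₀ φ ψ ξ) (volume : Measure Plane) := by
    refine AEStronglyMeasurable.congr (f := fun ξ => 1 / (((symbolSum φ₀ φ η ξ).toReal : ℝ) : ℂ))
      ?_ ?_
    · have := (measurable_symbolSum (φ₀ := φ₀) hη).ennreal_toReal
      exact Measurable.aestronglyMeasurable (by fun_prop)
    · filter_upwards [hmod] with ξ hξ
      rw [hξ.2]
  have hσb : ∀ᵐ ξ, ‖1 / modSymbol φ₀ φ ψ ξ‖ ≤ 1 / L.toReal := by
    filter_upwards [hmod, hlow, hup] with ξ h1 h2 h3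
    rw [h1.2, norm_div, norm_one, Complex.norm_real, Real.norm_of_nonneg ENNReal.toReal_nonneg]
    gcongr
    exact ne_top_of_le_ne_top ENNReal.ofReal_ne_top h3
  have hσr : ∀ᵐ ξ, conj (1 / modSymbol φ₀ φ ψ ξ) = 1 / modSymbol φ₀ φ ψ ξ := by
    filter_upwards [hmod] with ξ hξ
    rw [hξ.2, map_div₀, map_one, Complex.conj_ofReal]
  refine ⟨?_, ?_⟩
  · filter_upwards [hmod, hlow, hup] with ξ h1 h2 h3
    refine ⟨h1.1, _, h1.2, ?_⟩
    rw [ENNReal.ofReal_toReal (ne_top_of_le_ne_top ENNReal.ofReal_ne_top h3)]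
    -- As `0 ≤ η ≤ 1`, the symbol is already at most `B`; the extra term in the upper bound is
    -- slack.
    exact ⟨h2, h3.trans le_self_add⟩
  · choose dual hdual using exists_isFiltered hσm hσb
    refine ⟨fun l => dual (transl l φ₀), fun p => dual (packet ψ p.1 p.2), fun l => hdual _,
      fun p => hdual _, fun f => ?_⟩
    obtain ⟨f', hf'⟩ := exists_isFiltered hσm hσb f
    have hsum := summable_packets hP hη hψ hfin f'
    have hsum' := packetIndexEquiv.summable_iff.2 hsum
    obtain ⟨g₀, hg₀⟩ := hsum'.comp_injective Sum.inl_injective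
    obtain ⟨g₁, hg₁⟩ := hsum'.comp_injective Sum.inr_injective
    have hS := packetIndexEquiv.hasSum_iff.1 (HasSum.sum hg₀ hg₁)
    refine ⟨g₀, g₁, ?_, ?_, ?_, ?_⟩
    · rw [← (latticeEquiv hP).hasSum_iff]
      refine hg₀.congr_fun fun n => ?_
      simp only [Function.comp_apply]
      -- The real multiplier passes from the dual packet to `f`, which reduces the series to the one
      -- already summed for `f'`.
      rw [inner_filtered hσr (hdual _) hf']
      rfl
    · rw [← ((Equiv.refl ScaleRot).prodCongr (latticeEquiv hP)).hasSum_iff]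
      refine hg₁.congr_fun fun p => ?_
      simp only [Function.comp_apply]
      rw [inner_filtered hσr (hdual _) hf']
      rfl
    · have h1 := norm_sub_synthesis_le h hP hη hψ hfin hne hf' hS
      have h2 : ‖f'‖ ≤ 1 / L.toReal * ‖f‖ := by
        rw [← Lp.norm_fourier_eq f', ← Lp.norm_fourier_eq f]
        refine Lp.norm_le_mul_norm_of_ae_le_mul ?_
        filter_upwards [hf', hσb] with ξ a1 a2
        rw [a1, norm_mul]
        gcongr
      have h3 := h1.trans (mul_le_mul_of_nonneg_left h2 ENNReal.toReal_nonneg)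
      have hΔt : latticeDelta φ₀ φ P ≠ ⊤ := (hΔ.trans (lt_top_iff_ne_top.2 hLt)).ne
      refine (ENNReal.toReal_le_toReal enorm_ne_top (ENNReal.mul_ne_top
        (ENNReal.div_ne_top hΔt hL0) enorm_ne_top)).1 ?_
      rw [toReal_enorm, ENNReal.toReal_mul, ENNReal.toReal_div, toReal_enorm]
      exact h3.trans_eq (by ring)
    -- The assumption `Δ < L ≤ A` supplies the a priori bound needed when the lattice is coarse.
    · have h1 := latticeDelta_le hδ hς h hP (hΔ.le.trans hLA)
      refine (mul_le_mul_left (ENNReal.div_le_div_right h1 L) _).trans_eq ?_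
      simp only [div_eq_mul_inv]
      ring
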